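/- Rings are associative but need not have a unit. Let $R$ be a ring, $P$ and $Q$ $R$-bimodules, and $\psi:P\otimes_R Q\to R$ an $R$-bimodule homomorphism. For $r\in R$ let $\Delta(r):Q\to Q$, $\Delta(r)(q)=rq$; for $p\in P$, $q\in Q$ let $\theta_{q,p}:Q\to Q$, $x\mapsto q\,\psi(p\otimes x)$, and $\theta_{p,q}:P\to P$, $y\mapsto\psi(y\otimes q)p$; let $\mathcal F_P(Q)$ and $\mathcal F_Q(P)$ be the additive spans of the $\theta_{q,p}$ and of the $\theta_{p,q}$, respectively. Assume condition (FS): for all finite sets $\{q_1,\dots,q_n\}\subseteq Q$ and $\{p_1,\dots,p_m\}\subseteq P$ there are $\Theta\in\mathcal F_P(Q)$ and $\Omega\in\mathcal F_Q(P)$ with $\Theta(q_i)=q_i$ and $\Omega(p_j)=p_j$ for all $i,j$. A covariant representation $(S,T,\sigma,B)$ consists of a ring $B$, additive maps $S:P\to B$, $T:Q\to B$ and a ring homomorphism $\sigma:R\to B$ with $S(pr)=S(p)\sigma(r)$, $S(rp)=\sigma(r)S(p)$, $T(qr)=T(q)\sigma(r)$, $T(rq)=\sigma(r)T(q)$ and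 $\sigma(\psi(p\otimes q))=S(p)T(q)$. It is surjective if $\sigma(R)\cup T(Q)\cup S(P)$ generates the ring $B$, injective if $\sigma$ is injective, and graded if $B$ has a $\mathbb Z$-grading $\bigoplus_n B^{(n)}$ with $\sigma(R)\subseteq B^{(0)}$, $T(Q)\subseteq B^{(1)}$, $S(P)\subseteq B^{(-1)}$. Let $\pi_{T,S}:\mathcal F_P(Q)\to B$ be the ring homomorphism with $\pi_{T,S}(\theta_{q,p})=T(q)S(p)$ (it exists by (FS)), and put $J_{(S,T,\sigma,B)}=\{r\in R:\sigma(r)\in\pi_{T,S}(\mathcal F_P(Q))\}$. A two-sided ideal $J$ of $R$ is $\psi$-compatible if $\Delta(J)\subseteq\mathcal F_P(Q)$, and then faithful if $J\cap\ker\Delta=\{0\}$; a representation is Cuntz–Pimsner invariant relative to such a $J$ if $\pi_{T,S}(\Delta(x))=\sigma(x)$ for all $x\in J$. Let $(\iota_P,\iota_Q,\iota_R,\mathcal T)$ be the universal covariant representation (the Toeplitz representation), let $\mathcal T(J)$ be the two-sided ideal of $\mathcal T$ generated by $\iota_R(x)-\pi_{\iota_Q,\iota_P}(\Delta(x))$,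 $x\in J$, let $\mathcal O(J)=\mathcal T/\mathcal T(J)$, and let $\iota_P^J,\iota_Q^J,\iota_R^J$ be the compositions of $\iota_P,\iota_Q,\iota_R$ with the quotient map. Let $(S,T,\sigma,B)$ be a covariant representation. For every faithful $\psi$-compatible two-sided ideal $J$ of $R$: 1. If there is a ring homomorphism $\eta:\mathcal O(J)\to B$ with $\eta\circ\iota_Q^J=T$, $\eta\circ\iota_P^J=S$ and $\eta\circ\iota_R^J=\sigma$, then $(S,T,\sigma,B)$ is Cuntz–Pimsner invariant relative to $J$. 2. If $(S,T,\sigma,B)$ is Cuntz–Pimsner invariant relative to $J$, then there is a unique ring homomorphism $\eta^J:\mathcal O(J)\to B$ with $\eta^J\circ\iota_Q^J=T$, $\eta^J\circ\iota_P^J=S$ and $\eta^J\circ\iota_R^J=\sigma$. 3. If $(S,T,\sigma,B)$ is Cuntz–Pimsner invariant relative to $J$, then $\eta^J$ is an isomorphism if and only if $(S,T,\sigma,B)$ is surjective, injective and graded and $J=J_{(S,T,\sigma,B)}$. Moreover, if $(S,T,\sigma,B)$ is surjective, injective and graded, then there are a faithful $\psi$-compatible two-sided ideal $J$ of $R$ and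 a ring isomorphism $e:\mathcal O(J)\to B$ with $e\circ\iota_Q^J=T$, $e\circ\iota_P^J=S$ and $e\circ\iota_R^J=\sigma$. -/

import Mathlib

open scoped TensorProduct RightActions

namespace CuntzPimsner

/-! ### Bimodules over rings that need not have a unit

Throughout, "ring" means associative ring, not necessarily unital (`NonUnitalRing`), and ring
homomorphisms are additive and multiplicative maps (`→ₙ+*`).  The right action `m · r` is written
`m <• r`. -/

/-- An `R`-bimodule over a not necessarily unital ring `R`. -/
class Bimodule (R : Type*) (M : Type*) [NonUnitalRing R] [AddCommGroup M] where
  /-- The left action. -/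
  [toSMul : SMul R M]
  /-- The right action. -/
  [toOpSMul : SMul Rᵐᵒᵖ M]
  lsmul_add : ∀ (r : R) (m m' : M), r • (m + m') = r • m + r • m'
  add_lsmul : ∀ (r r' : R) (m : M), (r + r') • m = r • m + r' • m
  mul_lsmul : ∀ (r r' : R) (m : M), (r * r') • m = r • (r' • m)
  rsmul_add : ∀ (m m' : M) (r : R), (m + m') <• r = m <• r + m' <• r
  add_rsmul : ∀ (m : M) (r r' : R), m <• (r + r') = m <• r + m <• r'
  mul_rsmul : ∀ (m : M) (r r' : R), m <• (r * r') = (m <• r) <• r'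
  lsmul_rsmul : ∀ (r : R) (m : M) (r' : R), (r • m) <• r' = r • (m <• r')

attribute [reducible, instance] Bimodule.toSMul Bimodule.toOpSMul

/-- The regular bimodule. -/
instance regularBimodule (R : Type*) [NonUnitalRing R] : Bimodule R R where
  toSMul := inferInstance
  toOpSMul := inferInstance
  lsmul_add := mul_add
  add_lsmul := add_mul
  mul_lsmul := mul_assoc
  rsmul_add := add_mul
  add_rsmul := mul_add
  mul_rsmul m r r' := (mul_assoc m r r').symm
  lsmul_rsmul := mul_assoc

section Bimodules

variable (R : Type*) [NonUnitalRing R] {M N : Type*} [AddCommGroup M] [AddCommGroup N]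
  [Bimodule R M] [Bimodule R N]

/-- Left multiplication by `r` as an additive endomorphism; on `Q` this is `Δ(r) : q ↦ r q`. -/
def lmul (M : Type*) [AddCommGroup M] [Bimodule R M] (r : R) : AddMonoid.End M :=
  AddMonoidHom.mk' (fun m => r • m) (Bimodule.lsmul_add r)

theorem End.mul_apply (f g : AddMonoid.End M) (x : M) : (f * g) x = f (g x) := rfl

theorem End.add_apply (f g : AddMonoid.End M) (x : M) : (f + g) x = f x + g x := rfl

theorem End.neg_apply (f : AddMonoid.End M) (x : M) : (-f) x = -f x := rfl

/-- A homomorphism of `R`-bimodules. -/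
structure BimoduleHom (M N : Type*) [AddCommGroup M] [AddCommGroup N]
    [Bimodule R M] [Bimodule R N] extends M →+ N where
  map_lsmul' : ∀ (r : R) (m : M), toFun (r • m) = r • toFun m
  map_rsmul' : ∀ (m : M) (r : R), toFun (m <• r) = toFun m <• r

/-! ### The balanced tensor product -/

/-- The subgroup of `P ⊗ Q` (tensor product over `ℤ`) generated by the elements
`p r ⊗ q - p ⊗ r q`. -/
def balancedSubgroup (P Q : Type*) [AddCommGroup P] [AddCommGroup Q]
    [Bimodule R P] [Bimodule R Q] : AddSubgroup (P ⊗[ℤ] Q) :=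
  AddSubgroup.closure {x | ∃ (p : P) (r : R) (q : Q), x = (p <• r) ⊗ₜ[ℤ] q - p ⊗ₜ[ℤ] (r • q)}

/-- The `R`-balanced tensor product `P ⊗_R Q`. -/
def BalancedTensor (P Q : Type*) [AddCommGroup P] [AddCommGroup Q]
    [Bimodule R P] [Bimodule R Q] : Type _ :=
  (P ⊗[ℤ] Q) ⧸ balancedSubgroup R P Q

end Bimodules

namespace BalancedTensor

variable {R : Type*} [NonUnitalRing R] {P Q : Type*} [AddCommGroup P] [AddCommGroup Q]
  [Bimodule R P] [Bimodule R Q]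

instance : AddCommGroup (BalancedTensor R P Q) :=
  inferInstanceAs (AddCommGroup ((P ⊗[ℤ] Q) ⧸ balancedSubgroup R P Q))

variable (R) in
/-- The pure tensor `p ⊗ q` in `P ⊗_R Q`. -/
def tmul (p : P) (q : Q) : BalancedTensor R P Q :=
  QuotientAddGroup.mk' (balancedSubgroup R P Q) (p ⊗ₜ[ℤ] q)

theorem add_tmul (p p' : P) (q : Q) : tmul R (p + p') q = tmul R p q + tmul R p' q := by
  simp only [tmul, TensorProduct.add_tmul]
  exact map_add _ _ _

theorem tmul_add (p : P) (q q' : Q) : tmul R p (q + q') = tmul R p q + tmul R p q' := by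
  simp only [tmul, TensorProduct.tmul_add]
  exact map_add _ _ _

theorem rsmul_tmul (p : P) (r : R) (q : Q) : tmul R (p <• r) q = tmul R p (r • q) := by
  refine (QuotientAddGroup.eq_iff_sub_mem).2 ?_
  exact AddSubgroup.subset_closure ⟨p, r, q, rfl⟩

/-- Two additive maps on `P ⊗_R Q` agreeing on pure tensors are equal. -/
theorem hom_ext {A : Type*} [AddCommGroup A] {f g : BalancedTensor R P Q →+ A}
    (h : ∀ p q, f (tmul R p q) = g (tmul R p q)) : f = g := by
  refine QuotientAddGroup.addMonoidHom_ext _ ?_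
  ext x
  induction x using TensorProduct.induction_on with
  | zero => simp
  | tmul p q => exact h p q
  | add x y hx hy => simp only [map_add, hx, hy]

/-- The additive map `p ⊗ q ↦ f p ⊗ g q`, for `f`, `g` compatible with the inner actions. -/
def map (f : P →+ P) (g : Q →+ Q)
    (hf : ∀ p (r : R), f (p <• r) = f p <• r)
    (hg : ∀ (r : R) q, g (r • q) = r • g q) : BalancedTensor R P Q →+ BalancedTensor R P Q :=
  QuotientAddGroup.map (balancedSubgroup R P Q) (balancedSubgroup R P Q)
    (TensorProduct.map f.toIntLinearMap g.toIntLinearMap).toAddMonoidHom <| by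
      refine (AddSubgroup.closure_le _).2 ?_
      rintro _ ⟨p, r, q, rfl⟩
      refine AddSubgroup.subset_closure ⟨f p, r, g q, ?_⟩
      have h1 := hf p r
      have h2 := hg r q
      simp only [map_sub, LinearMap.toAddMonoidHom_coe, TensorProduct.map_tmul,
        AddMonoidHom.coe_toIntLinearMap, h1, h2]

theorem map_tmul (f : P →+ P) (g : Q →+ Q)
    (hf : ∀ p (r : R), f (p <• r) = f p <• r)
    (hg : ∀ (r : R) q, g (r • q) = r • g q) (p : P) (q : Q) :
    map f g hf hg (tmul R p q) = tmul R (f p) (g q) := rfl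

/-- Left multiplication `r (p ⊗ q) = (r p) ⊗ q` on `P ⊗_R Q`. -/
def lact (r : R) : BalancedTensor R P Q →+ BalancedTensor R P Q :=
  map (AddMonoidHom.mk' (fun p => r • p) (Bimodule.lsmul_add r)) (.id Q) (fun p r' => (Bimodule.lsmul_rsmul r p r').symm) (fun _ _ => rfl)

/-- Right multiplication `(p ⊗ q) r = p ⊗ (q r)` on `P ⊗_R Q`. -/
def ract (r : R) : BalancedTensor R P Q →+ BalancedTensor R P Q :=
  map (.id P) (AddMonoidHom.mk' (fun q => q <• r) (fun q q' => Bimodule.rsmul_add q q' r)) (fun _ _ => rfl) (fun r' q => Bimodule.lsmul_rsmul r' q r)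

theorem lact_tmul (r : R) (p : P) (q : Q) : lact r (tmul R p q) = tmul R (r • p) q := rfl

theorem ract_tmul (r : R) (p : P) (q : Q) : ract r (tmul R p q) = tmul R p (q <• r) := rfl

/-- The bimodule structure `r (p ⊗ q) = (r p) ⊗ q`, `(p ⊗ q) r = p ⊗ (q r)` on `P ⊗_R Q`. -/
instance : Bimodule R (BalancedTensor R P Q) where
  toSMul := ⟨fun r x => lact r x⟩
  toOpSMul := ⟨fun r x => ract r.unop x⟩
  lsmul_add r := map_add (lact r)
  rsmul_add m m' r := map_add (ract r) m m'
  add_lsmul r r' m := by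
    refine DFunLike.congr_fun (f := lact (r + r')) (g := lact r + lact r') (hom_ext ?_) m
    intro p q
    rw [AddMonoidHom.add_apply]
    simp only [lact_tmul, Bimodule.add_lsmul, add_tmul]
  mul_lsmul r r' m := by
    refine DFunLike.congr_fun (f := lact (r * r')) (g := (lact r).comp (lact r')) (hom_ext ?_) m
    intro p q
    rw [AddMonoidHom.comp_apply]
    simp only [lact_tmul, Bimodule.mul_lsmul]
  add_rsmul m r r' := by
    refine DFunLike.congr_fun (f := ract (r + r')) (g := ract r + ract r') (hom_ext ?_) m
    intro p q
    rw [AddMonoidHom.add_apply]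
    simp only [ract_tmul, Bimodule.add_rsmul, tmul_add]
  mul_rsmul m r r' := by
    refine DFunLike.congr_fun (f := ract (r * r')) (g := (ract r').comp (ract r)) (hom_ext ?_) m
    intro p q
    rw [AddMonoidHom.comp_apply]
    simp only [ract_tmul, Bimodule.mul_rsmul]
  lsmul_rsmul r m r' := by
    refine DFunLike.congr_fun (f := (ract r').comp (lact r)) (g := (lact r).comp (ract r'))
      (hom_ext ?_) m
    intro p q
    rw [AddMonoidHom.comp_apply, AddMonoidHom.comp_apply]
    simp only [lact_tmul, ract_tmul]

end BalancedTensor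

/-! ### `R`-systems and finite rank operators -/

/-- The map `ψ : P ⊗_R Q → R` of an `R`-system `(P, Q, ψ)`. -/
abbrev SystemMap (R P Q : Type*) [NonUnitalRing R] [AddCommGroup P] [AddCommGroup Q]
    [Bimodule R P] [Bimodule R Q] : Type _ :=
  BimoduleHom R (BalancedTensor R P Q) R

section System

variable {R P Q : Type*} [NonUnitalRing R] [AddCommGroup P] [AddCommGroup Q]
  [Bimodule R P] [Bimodule R Q]

/-- The element `ψ(p ⊗ q)` of `R`. -/
def SystemMap.pair (ψ : SystemMap R P Q) (p : P) (q : Q) : R :=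
  ψ.toAddMonoidHom (BalancedTensor.tmul R p q)

namespace SystemMap

variable (ψ : SystemMap R P Q)

theorem pair_add_left (p p' : P) (q : Q) : ψ.pair (p + p') q = ψ.pair p q + ψ.pair p' q := by
  simp [pair, BalancedTensor.add_tmul]

theorem pair_add_right (p : P) (q q' : Q) : ψ.pair p (q + q') = ψ.pair p q + ψ.pair p q' := by
  simp [pair, BalancedTensor.tmul_add]

theorem pair_rsmul (p : P) (q : Q) (r : R) : ψ.pair p (q <• r) = ψ.pair p q * r :=
  ψ.map_rsmul' (BalancedTensor.tmul R p q) r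

theorem pair_lsmul (r : R) (p : P) (q : Q) : ψ.pair (r • p) q = r * ψ.pair p q :=
  ψ.map_lsmul' r (BalancedTensor.tmul R p q)

/-- The rank one operator `θ_{q,p} : Q → Q`, `x ↦ q ψ(p ⊗ x)`. -/
def theta (q : Q) (p : P) : AddMonoid.End Q :=
  AddMonoidHom.mk' (fun x => q <• ψ.pair p x)
    (fun x y => by rw [pair_add_right, Bimodule.add_rsmul])

/-- The rank one operator `θ_{p,q} : P → P`, `y ↦ ψ(y ⊗ q) p`. -/
def theta' (p : P) (q : Q) : AddMonoid.End P :=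
  AddMonoidHom.mk' (fun y => ψ.pair y q • p)
    (fun x y => by rw [pair_add_left, Bimodule.add_lsmul])

theorem theta_apply (q : Q) (p : P) (x : Q) : ψ.theta q p x = q <• ψ.pair p x := rfl

theorem theta'_apply (p : P) (q : Q) (y : P) : ψ.theta' p q y = ψ.pair y q • p := rfl

theorem theta_mul_theta (q q' : Q) (p p' : P) :
    ψ.theta q p * ψ.theta q' p' = ψ.theta (ψ.theta q p q') p' := by
  ext x
  simp only [End.mul_apply, theta_apply, pair_rsmul, Bimodule.mul_rsmul]

theorem theta'_mul_theta' (p p' : P) (q q' : Q) :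
    ψ.theta' p q * ψ.theta' p' q' = ψ.theta' (ψ.theta' p q p') q' := by
  ext x
  simp only [End.mul_apply, theta'_apply, pair_lsmul, Bimodule.mul_lsmul]

/-- `𝓕_P(Q)`: the additive span of all the operators `θ_{q,p}`, which is a subring. -/
def finiteRank : NonUnitalSubring (AddMonoid.End Q) where
  __ := AddSubgroup.closure {Θ | ∃ q p, Θ = ψ.theta q p}
  mul_mem' := by
    intro a b ha hb
    change a ∈ AddSubgroup.closure _ at ha
    change b ∈ AddSubgroup.closure _ at hb
    change a * b ∈ AddSubgroup.closure _
    induction ha, hb using AddSubgroup.closure_induction₂ with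
    | mem x y hx hy =>
      obtain ⟨q, p, rfl⟩ := hx
      obtain ⟨q', p', rfl⟩ := hy
      exact AddSubgroup.subset_closure ⟨_, _, ψ.theta_mul_theta q q' p p'⟩
    | zero_left x _ => rw [zero_mul]; exact zero_mem _
    | zero_right x _ => rw [mul_zero]; exact zero_mem _
    | add_left x y z _ _ _ h1 h2 => rw [add_mul]; exact add_mem h1 h2
    | add_right x y z _ _ _ h1 h2 => rw [mul_add]; exact add_mem h1 h2
    | neg_left x y _ _ h => rw [neg_mul]; exact neg_mem h
    | neg_right x y _ _ h => rw [mul_neg]; exact neg_mem h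

/-- `𝓕_Q(P)`: the additive span of all the operators `θ_{p,q}`, which is a subring. -/
def finiteRank' : NonUnitalSubring (AddMonoid.End P) where
  __ := AddSubgroup.closure {Θ | ∃ p q, Θ = ψ.theta' p q}
  mul_mem' := by
    intro a b ha hb
    change a ∈ AddSubgroup.closure _ at ha
    change b ∈ AddSubgroup.closure _ at hb
    change a * b ∈ AddSubgroup.closure _
    induction ha, hb using AddSubgroup.closure_induction₂ with
    | mem x y hx hy =>
      obtain ⟨q, p, rfl⟩ := hx
      obtain ⟨q', p', rfl⟩ := hy
      exact AddSubgroup.subset_closure ⟨_, _, ψ.theta'_mul_theta' q q' p p'⟩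
    | zero_left x _ => rw [zero_mul]; exact zero_mem _
    | zero_right x _ => rw [mul_zero]; exact zero_mem _
    | add_left x y z _ _ _ h1 h2 => rw [add_mul]; exact add_mem h1 h2
    | add_right x y z _ _ _ h1 h2 => rw [mul_add]; exact add_mem h1 h2
    | neg_left x y _ _ h => rw [neg_mul]; exact neg_mem h
    | neg_right x y _ _ h => rw [mul_neg]; exact neg_mem h

theorem theta_mem (q : Q) (p : P) : ψ.theta q p ∈ ψ.finiteRank :=
  AddSubgroup.subset_closure ⟨q, p, rfl⟩

/-- Condition (FS). -/
def FS : Prop :=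
  ∀ (s : Finset Q) (t : Finset P),
    ∃ Θ ∈ ψ.finiteRank, ∃ Ω ∈ ψ.finiteRank', (∀ q ∈ s, Θ q = q) ∧ (∀ p ∈ t, Ω p = p)

/-- A two-sided ideal `J` of `R` is `ψ`-compatible if `J ⊆ Δ⁻¹(𝓕_P(Q))`. -/
def Compatible (J : TwoSidedIdeal R) : Prop :=
  ∀ x ∈ J, lmul R Q x ∈ ψ.finiteRank

end SystemMap

variable (Q) in
/-- `J ∩ ker Δ = {0}`. -/
def Faithful (J : TwoSidedIdeal R) : Prop :=
  ∀ x ∈ J, lmul R Q x = 0 → x = 0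

/-! ### Covariant representations -/

/-- A covariant representation `(S, T, σ, B)` of `(P, Q, ψ)` on the ring `B`. -/
structure CovRep (ψ : SystemMap R P Q) (B : Type*) [NonUnitalRing B] where
  S : P →+ B
  T : Q →+ B
  σ : R →ₙ+* B
  S_rsmul : ∀ (p : P) (r : R), S (p <• r) = S p * σ r
  S_lsmul : ∀ (r : R) (p : P), S (r • p) = σ r * S p
  T_rsmul : ∀ (q : Q) (r : R), T (q <• r) = T q * σ r
  T_lsmul : ∀ (r : R) (q : Q), T (r • q) = σ r * T q
  σ_pair : ∀ (p : P) (q : Q), σ (ψ.pair p q) = S p * T q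

namespace CovRep

variable {ψ : SystemMap R P Q} {B : Type*} [NonUnitalRing B]

/-- The image of a covariant representation under a ring homomorphism. -/
def comp {C : Type*} [NonUnitalRing C] (φ : B →ₙ+* C) (V : CovRep ψ B) : CovRep ψ C where
  S := (φ : B →+ C).comp V.S
  T := (φ : B →+ C).comp V.T
  σ := φ.comp V.σ
  S_rsmul p r := by simp [V.S_rsmul]
  S_lsmul r p := by simp [V.S_lsmul]
  T_rsmul q r := by simp [V.T_rsmul]
  T_lsmul r q := by simp [V.T_lsmul]
  σ_pair p q := by simp [V.σ_pair]

/-- The representation is surjective: `σ(R) ∪ T(Q) ∪ S(P)` generates the ring `B`. -/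
def Surjective (V : CovRep ψ B) : Prop :=
  NonUnitalSubring.closure (Set.range V.σ ∪ Set.range V.T ∪ Set.range V.S) = ⊤

/-- The representation is injective: `σ` is injective. -/
def Injective (V : CovRep ψ B) : Prop := Function.Injective V.σ

/-- The representation is graded: `B` has a `ℤ`-grading with `σ(R) ⊆ B⁽⁰⁾`, `T(Q) ⊆ B⁽¹⁾` and
`S(P) ⊆ B⁽⁻¹⁾`. -/
def Graded (V : CovRep ψ B) : Prop :=
  ∃ 𝒜 : ℤ → AddSubgroup B, DirectSum.IsInternal 𝒜 ∧
    (∀ m n : ℤ, ∀ a ∈ 𝒜 m, ∀ b ∈ 𝒜 n, a * b ∈ 𝒜 (m + n)) ∧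
    (∀ r, V.σ r ∈ 𝒜 0) ∧ (∀ q, V.T q ∈ 𝒜 1) ∧ (∀ p, V.S p ∈ 𝒜 (-1))

/-- The ring homomorphism `η` carries the representation `V` to the representation `W`. -/
def Intertwines {C : Type*} [NonUnitalRing C] (V : CovRep ψ B) (W : CovRep ψ C)
    (η : B →ₙ+* C) : Prop :=
  (∀ q, η (V.T q) = W.T q) ∧ (∀ p, η (V.S p) = W.S p) ∧ (∀ r, η (V.σ r) = W.σ r)

/-! The ring homomorphism `π_{T,S} : 𝓕_P(Q) → B` with `π_{T,S}(θ_{q,p}) = T(q) S(p)`. -/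

/-- `Θ` and `b` have a common presentation `Θ = ∑ θ_{q,p}`, `b = ∑ T(q) S(p)`: the graph of
`π_{T,S}`. -/
def piGraph (V : CovRep ψ B) : AddSubgroup (AddMonoid.End Q × B) :=
  AddSubgroup.closure {x | ∃ q p, x = (ψ.theta q p, V.T q * V.S p)}

theorem piGraph_mul_T (V : CovRep ψ B) {x : AddMonoid.End Q × B} (hx : x ∈ V.piGraph) (q : Q) :
    x.2 * V.T q = V.T (x.1 q) := by
  induction hx using AddSubgroup.closure_induction with
  | mem x hx =>
    obtain ⟨q', p, rfl⟩ := hx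
    simp only [SystemMap.theta_apply, V.T_rsmul, V.σ_pair, mul_assoc]
  | zero => simp
  | add x y _ _ hx hy => simp [add_mul, hx, hy, End.add_apply]
  | neg x _ hx => simp [hx, End.neg_apply]

theorem piGraph_mul_right (V : CovRep ψ B) {x : AddMonoid.End Q × B} (hx : x ∈ V.piGraph)
    (q : Q) (p : P) : x.2 * (V.T q * V.S p) = V.T (x.1 q) * V.S p := by
  rw [← mul_assoc, V.piGraph_mul_T hx]

theorem S_mul_TS (V : CovRep ψ B) {Ω : AddMonoid.End P} (hΩ : Ω ∈ ψ.finiteRank') :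
    ∃ b : B, (∀ y, V.S (Ω y) = V.S y * b) ∧
      ∀ x ∈ V.piGraph, x.1 = 0 → x.2 * b = 0 := by
  change Ω ∈ AddSubgroup.closure _ at hΩ
  induction hΩ using AddSubgroup.closure_induction with
  | mem Ω h =>
    obtain ⟨p, q, rfl⟩ := h
    refine ⟨V.T q * V.S p, fun y => ?_, fun x hx h0 => ?_⟩
    · rw [SystemMap.theta'_apply, V.S_lsmul, V.σ_pair, mul_assoc]
    · rw [V.piGraph_mul_right hx, h0]; simp
  | zero => exact ⟨0, by simp, by simp⟩
  | add x y _ _ hx hy =>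
    obtain ⟨b, hb, hb'⟩ := hx
    obtain ⟨c, hc, hc'⟩ := hy
    exact ⟨b + c, fun y => by simp [hb, hc, mul_add, End.add_apply],
      fun x hx h0 => by rw [mul_add, hb' x hx h0, hc' x hx h0, add_zero]⟩
  | neg x _ hx =>
    obtain ⟨b, hb, hb'⟩ := hx
    exact ⟨-b, fun y => by simp [hb, End.neg_apply], fun x hx h0 => by rw [mul_neg, hb' x hx h0, neg_zero]⟩

theorem piGraph_finite (V : CovRep ψ B) {x : AddMonoid.End Q × B} (hx : x ∈ V.piGraph) :
    ∃ t : Finset P, ∀ b : B, (∀ p ∈ t, V.S p * b = V.S p) → x.2 * b = x.2 := by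
  classical
  induction hx using AddSubgroup.closure_induction with
  | mem x hx =>
    obtain ⟨q, p, rfl⟩ := hx
    exact ⟨{p}, fun b hb => by simp [mul_assoc, hb p (by simp)]⟩
  | zero => exact ⟨∅, by simp⟩
  | add x y _ _ hx hy =>
    obtain ⟨s, hs⟩ := hx
    obtain ⟨t, ht⟩ := hy
    refine ⟨s ∪ t, fun b hb => ?_⟩
    rw [Prod.snd_add, add_mul, hs b fun p hp => hb p (by simp [hp]),
      ht b fun p hp => hb p (by simp [hp])]
  | neg x _ hx =>
    obtain ⟨s, hs⟩ := hx
    exact ⟨s, fun b hb => by simp [hs b hb]⟩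

/-- Under (FS), `∑ θ_{q,p} = 0` implies `∑ T(q) S(p) = 0`. -/
theorem piGraph_zero (hFS : ψ.FS) (V : CovRep ψ B) {x : AddMonoid.End Q × B}
    (hx : x ∈ V.piGraph) (h0 : x.1 = 0) : x.2 = 0 := by
  obtain ⟨t, ht⟩ := V.piGraph_finite hx
  obtain ⟨-, -, Ω, hΩ, -, hΩt⟩ := hFS ∅ t
  obtain ⟨b, hb, hb'⟩ := V.S_mul_TS hΩ
  rw [← ht b fun p hp => by rw [← hb, hΩt p hp]]
  exact hb' x hx h0

theorem piGraph_unique (hFS : ψ.FS) (V : CovRep ψ B) {Θ : AddMonoid.End Q} {b c : B}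
    (hb : (Θ, b) ∈ V.piGraph) (hc : (Θ, c) ∈ V.piGraph) : b = c := by
  have h := V.piGraph_zero hFS (sub_mem hb hc) (by simp)
  exact sub_eq_zero.1 h

theorem piGraph_total (V : CovRep ψ B) (Θ : ψ.finiteRank) : ∃ b, (Θ.1, b) ∈ V.piGraph := by
  obtain ⟨Θ, hΘ⟩ := Θ
  change Θ ∈ AddSubgroup.closure _ at hΘ
  induction hΘ using AddSubgroup.closure_induction with
  | mem Θ h =>
    obtain ⟨q, p, rfl⟩ := h
    exact ⟨_, AddSubgroup.subset_closure ⟨q, p, rfl⟩⟩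
  | zero => exact ⟨0, zero_mem V.piGraph⟩
  | add x y _ _ hx hy =>
    obtain ⟨b, hb⟩ := hx
    obtain ⟨c, hc⟩ := hy
    exact ⟨b + c, add_mem hb hc⟩
  | neg x _ hx =>
    obtain ⟨b, hb⟩ := hx
    exact ⟨-b, neg_mem hb⟩

theorem piGraph_mul (V : CovRep ψ B) {x y : AddMonoid.End Q × B} (hx : x ∈ V.piGraph)
    (hy : y ∈ V.piGraph) : x * y ∈ V.piGraph := by
  induction hy using AddSubgroup.closure_induction with
  | mem y hy =>
    obtain ⟨q, p, rfl⟩ := hy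
    refine AddSubgroup.subset_closure ⟨x.1 q, p, Prod.ext ?_ (V.piGraph_mul_right hx q p)⟩
    ext z
    have hr : ∀ (q : Q) (r : R), x.1 (q <• r) = x.1 q <• r := by
      intro q r
      clear * - hx
      induction hx using AddSubgroup.closure_induction with
      | mem x hx =>
        obtain ⟨q', p, rfl⟩ := hx
        simp only [SystemMap.theta_apply, SystemMap.pair_rsmul, Bimodule.mul_rsmul]
      | zero => exact (map_zero (AddMonoidHom.mk' (fun q : Q => q <• r)
          (fun q q' => Bimodule.rsmul_add q q' r))).symm
      | add x y _ _ hx hy =>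
        simp only [Prod.fst_add, End.add_apply, hx, hy, Bimodule.rsmul_add]
      | neg x _ hx =>
        simp only [Prod.fst_neg, End.neg_apply, hx]
        exact (map_neg (AddMonoidHom.mk' (fun q : Q => q <• r)
          (fun q q' => Bimodule.rsmul_add q q' r)) _).symm
    exact hr q _
  | zero => rw [mul_zero]; exact zero_mem _
  | add a b _ _ ha hb => rw [mul_add]; exact add_mem ha hb
  | neg a _ ha => rw [mul_neg]; exact neg_mem ha

/-- The ring homomorphism `π_{T,S} : 𝓕_P(Q) → B`, `π_{T,S}(θ_{q,p}) = T(q) S(p)`, for an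
`R`-system satisfying (FS). -/
noncomputable def piHom (hFS : ψ.FS) (V : CovRep ψ B) : ψ.finiteRank →ₙ+* B where
  toFun Θ := (V.piGraph_total Θ).choose
  map_zero' := V.piGraph_unique hFS (V.piGraph_total 0).choose_spec (zero_mem V.piGraph)
  map_add' x y := V.piGraph_unique hFS (V.piGraph_total (x + y)).choose_spec
    (add_mem (V.piGraph_total x).choose_spec (V.piGraph_total y).choose_spec)
  map_mul' x y := V.piGraph_unique hFS (V.piGraph_total (x * y)).choose_spec
    (V.piGraph_mul (V.piGraph_total x).choose_spec (V.piGraph_total y).choose_spec)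

theorem piHom_theta (hFS : ψ.FS) (V : CovRep ψ B) (q : Q) (p : P) :
    V.piHom hFS ⟨ψ.theta q p, ψ.theta_mem q p⟩ = V.T q * V.S p :=
  V.piGraph_unique hFS (V.piGraph_total _).choose_spec (AddSubgroup.subset_closure ⟨q, p, rfl⟩)

/-- The representation is Cuntz-Pimsner invariant relative to the `ψ`-compatible ideal `J`:
`π_{T,S}(Δ(x)) = σ(x)` for all `x ∈ J`. -/
def CPInvariant (hFS : ψ.FS) (V : CovRep ψ B) (J : TwoSidedIdeal R) (hJ : ψ.Compatible J) : Prop :=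
  ∀ (x : R) (hx : x ∈ J), V.piHom hFS ⟨lmul R Q x, hJ x hx⟩ = V.σ x

/-- The set `J_{(S,T,σ,B)} = {r ∈ R : σ(r) ∈ π_{T,S}(𝓕_P(Q))}`. -/
def idealSet (hFS : ψ.FS) (V : CovRep ψ B) : Set R :=
  {r | V.σ r ∈ Set.range (V.piHom hFS)}

end CovRep

/-! ### The Toeplitz ring

The universal ring generated by copies of `R`, `Q` and `P` subject to the relations of a covariant
representation, as a quotient of the free (non-unital) ring on the disjoint union of `R`, `Q`
and `P`. -/

/-- The free non-unital ring on a set `X`: the semigroup ring over `ℤ` of the free semigroup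
on `X`. -/
abbrev FreeNURing (X : Type*) : Type _ := MonoidAlgebra ℤ (FreeSemigroup X)

/-- The generator of the free ring attached to `x`. -/
noncomputable def FreeNURing.of {X : Type*} (x : X) : FreeNURing X :=
  MonoidAlgebra.single (FreeSemigroup.of x) 1

/-- Generators of the Toeplitz ring. -/
inductive Gen (R P Q : Type*) : Type _
  | r : R → Gen R P Q
  | q : Q → Gen R P Q
  | p : P → Gen R P Q

/-- The defining relations of the Toeplitz ring. -/
inductive ToeplitzRel (ψ : SystemMap R P Q) :
    FreeNURing (Gen R P Q) → FreeNURing (Gen R P Q) → Prop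
  | add_r (r r' : R) : ToeplitzRel ψ (.of (.r (r + r'))) (.of (.r r) + .of (.r r'))
  | mul_r (r r' : R) : ToeplitzRel ψ (.of (.r (r * r'))) (.of (.r r) * .of (.r r'))
  | add_q (q q' : Q) : ToeplitzRel ψ (.of (.q (q + q'))) (.of (.q q) + .of (.q q'))
  | add_p (p p' : P) : ToeplitzRel ψ (.of (.p (p + p'))) (.of (.p p) + .of (.p p'))
  | p_rsmul (p : P) (r : R) : ToeplitzRel ψ (.of (.p (p <• r))) (.of (.p p) * .of (.r r))
  | p_lsmul (r : R) (p : P) : ToeplitzRel ψ (.of (.p (r • p))) (.of (.r r) * .of (.p p))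
  | q_rsmul (q : Q) (r : R) : ToeplitzRel ψ (.of (.q (q <• r))) (.of (.q q) * .of (.r r))
  | q_lsmul (r : R) (q : Q) : ToeplitzRel ψ (.of (.q (r • q))) (.of (.r r) * .of (.q q))
  | pair (p : P) (q : Q) : ToeplitzRel ψ (.of (.r (ψ.pair p q))) (.of (.p p) * .of (.q q))

/-- The Toeplitz ring `𝓣_{(P,Q,ψ)}`. -/
def Toeplitz (ψ : SystemMap R P Q) : Type _ := (ringConGen (ToeplitzRel ψ)).Quotient

noncomputable instance (ψ : SystemMap R P Q) : NonUnitalRing (Toeplitz ψ) :=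
  inferInstanceAs (NonUnitalRing (ringConGen (ToeplitzRel ψ)).Quotient)

/-- The quotient map from the free ring onto the Toeplitz ring. -/
noncomputable def Toeplitz.mk (ψ : SystemMap R P Q) (x : FreeNURing (Gen R P Q)) : Toeplitz ψ :=
  RingCon.toQuotient (c := ringConGen (ToeplitzRel ψ)) x

theorem Toeplitz.mk_eq (ψ : SystemMap R P Q) {x y : FreeNURing (Gen R P Q)}
    (h : ToeplitzRel ψ x y) : Toeplitz.mk ψ x = Toeplitz.mk ψ y :=
  (RingCon.eq _).2 (RingConGen.Rel.of _ _ h)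

/-- The Toeplitz representation `(ι_P, ι_Q, ι_R, 𝓣_{(P,Q,ψ)})`. -/
noncomputable def toeplitzRep (ψ : SystemMap R P Q) : CovRep ψ (Toeplitz ψ) where
  S := AddMonoidHom.mk' (fun p => Toeplitz.mk ψ (.of (.p p)))
    (fun p p' => Toeplitz.mk_eq ψ (.add_p p p'))
  T := AddMonoidHom.mk' (fun q => Toeplitz.mk ψ (.of (.q q)))
    (fun q q' => Toeplitz.mk_eq ψ (.add_q q q'))
  σ := { AddMonoidHom.mk' (fun r => Toeplitz.mk ψ (.of (.r r)))
          (fun r r' => Toeplitz.mk_eq ψ (.add_r r r')) with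
         map_mul' := fun r r' => Toeplitz.mk_eq ψ (.mul_r r r') }
  S_rsmul p r := Toeplitz.mk_eq ψ (.p_rsmul p r)
  S_lsmul r p := Toeplitz.mk_eq ψ (.p_lsmul r p)
  T_rsmul q r := Toeplitz.mk_eq ψ (.q_rsmul q r)
  T_lsmul r q := Toeplitz.mk_eq ψ (.q_lsmul r q)
  σ_pair p q := Toeplitz.mk_eq ψ (.pair p q)

/-! ### Relative Cuntz-Pimsner rings -/

/-- `𝓣(J)`: the two-sided ideal of the Toeplitz ring generated by the elements
`ι_R(x) - π(Δ(x))`, `x ∈ J`. -/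
noncomputable def toeplitzIdeal {ψ : SystemMap R P Q} (hFS : ψ.FS) (J : TwoSidedIdeal R)
    (hJ : ψ.Compatible J) : TwoSidedIdeal (Toeplitz ψ) :=
  TwoSidedIdeal.span {y | ∃ (x : R) (hx : x ∈ J),
    y = (toeplitzRep ψ).σ x - (toeplitzRep ψ).piHom hFS ⟨lmul R Q x, hJ x hx⟩}

/-- The Cuntz-Pimsner ring `𝓞_{(P,Q,ψ)}(J) = 𝓣_{(P,Q,ψ)} / 𝓣(J)` relative to `J`. -/
def RelCP {ψ : SystemMap R P Q} (hFS : ψ.FS) (J : TwoSidedIdeal R) (hJ : ψ.Compatible J) :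
    Type _ :=
  (toeplitzIdeal hFS J hJ).ringCon.Quotient

noncomputable instance {ψ : SystemMap R P Q} (hFS : ψ.FS) (J : TwoSidedIdeal R)
    (hJ : ψ.Compatible J) : NonUnitalRing (RelCP hFS J hJ) :=
  inferInstanceAs (NonUnitalRing (toeplitzIdeal hFS J hJ).ringCon.Quotient)

/-- The quotient map `ρ_J : 𝓣_{(P,Q,ψ)} → 𝓞_{(P,Q,ψ)}(J)`. -/
noncomputable def rho {ψ : SystemMap R P Q} (hFS : ψ.FS) (J : TwoSidedIdeal R)
    (hJ : ψ.Compatible J) : Toeplitz ψ →ₙ+* RelCP hFS J hJ where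
  toFun x := RingCon.toQuotient (c := (toeplitzIdeal hFS J hJ).ringCon) x
  map_mul' _ _ := rfl
  map_zero' := rfl
  map_add' _ _ := rfl

/-- The Cuntz-Pimsner representation `(ι_P^J, ι_Q^J, ι_R^J, 𝓞_{(P,Q,ψ)}(J))` relative to `J`. -/
noncomputable def relCPRep {ψ : SystemMap R P Q} (hFS : ψ.FS) (J : TwoSidedIdeal R)
    (hJ : ψ.Compatible J) : CovRep ψ (RelCP hFS J hJ) :=
  (toeplitzRep ψ).comp (rho hFS J hJ)

end System

end CuntzPimsner

/-! Parts 1 and 2 are formal. An intertwining homomorphism carries one map `π` to the other, so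
invariance passes along it, and `𝓞(J)` is the quotient of the universal ring by exactly the
invariance relations.

For part 3, necessity requires that `𝓞(J)` itself be graded and injective with associated ideal `J`.
The grading comes from the invariant representation `(S t⁻¹, T t, σ)` over Laurent polynomials: by
universality it yields a coaction, whose eigenspaces are the graded pieces
(`CovRep.graded_of_bijective`). For the rest, the Toeplitz ring acts on a Fock module of functions
on words in `P`, with values in the unitization of `R` so that there is a vacuum vector of value
`1`. Outputs of `π` vanish at the empty word, and for `x ∈ J` the generator `ι_R(x) - π(Δ(x))` is
multiplication by `x` on the vacuum component and zero elsewhere (`fockRep_generator_apply`).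
Consequently elements of `𝓣(J)` produce functions with values in `J`, so `ι_R(r)` can agree with
some `π(Θ)` modulo `𝓣(J)` only if `r ∈ J` (`mem_of_relCPRep_eq`). Each element of `𝓣(J)` also kills
all functions vanishing on sufficiently short words. If `r` dies in `𝓞(J)`, then `r ∈ J`, and by
faithfulness it suffices that all `ψ(p ⊗ rq)` vanish; these die in `𝓞(J)` too and have a smaller
length bound, so induction gives `r = 0` (`relCPRep_injective`).

Sufficiency is a graded uniqueness theorem (`bijective_of_graded`). A grading on the target reduces
injectivity to homogeneous elements. Condition (FS) supplies local units in `π(𝓕_P(Q))`, so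
multiplication by `S(p)` or `T(q)` moves a kernel element to degree zero without losing information.
In degree zero the compressions `x ↦ S(p) x T(q)` shorten words; by induction they vanish on a
kernel element, which is then `σ(r) - π(Θ)`. Injectivity of the target and `J = J_{(S,T,σ,B)}` force
`r ∈ J` and `Θ = Δ(r)`, so it is zero. The last assertion takes `J = J_{(S,T,σ,B)}`. -/

namespace CuntzPimsner

/-! ### Nondegeneracy of the pairing and functoriality of `π` -/

variable {R P Q : Type*} [NonUnitalRing R] [AddCommGroup P] [AddCommGroup Q]
  [Bimodule R P] [Bimodule R Q] {ψ : SystemMap R P Q}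

/-- Under (FS), the pairing is nondegenerate on the side of `Q`. -/
theorem SystemMap.FS.eq_zero_right (hFS : ψ.FS) {q : Q} (h : ∀ p, ψ.pair p q = 0) : q = 0 := by
  obtain ⟨Θ, hΘ, -, -, hq, -⟩ := hFS {q} ∅
  rw [← hq q (by simp)]
  clear hq
  change Θ ∈ AddSubgroup.closure _ at hΘ
  induction hΘ using AddSubgroup.closure_induction with
  | mem Θ h' =>
    obtain ⟨q', p, rfl⟩ := h'
    rw [SystemMap.theta_apply, h]
    exact map_zero (AddMonoidHom.mk' (fun r : R => q' <• r) (Bimodule.add_rsmul q'))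
  | zero => rfl
  | add x y _ _ hx hy => rw [End.add_apply, hx, hy, add_zero]
  | neg x _ hx => rw [End.neg_apply, hx, neg_zero]

/-- Under (FS), the pairing is nondegenerate on the side of `P`. -/
theorem SystemMap.FS.eq_zero_left (hFS : ψ.FS) {p : P} (h : ∀ q, ψ.pair p q = 0) : p = 0 := by
  obtain ⟨-, -, Θ, hΘ, -, hp⟩ := hFS ∅ {p}
  rw [← hp p (by simp)]
  clear hp
  change Θ ∈ AddSubgroup.closure _ at hΘ
  induction hΘ using AddSubgroup.closure_induction with
  | mem Θ h' =>
    obtain ⟨p', q, rfl⟩ := h'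
    rw [SystemMap.theta'_apply, h]
    exact map_zero (AddMonoidHom.mk' (fun r : R => r • p') (fun r s => Bimodule.add_lsmul r s p'))
  | zero => rfl
  | add x y _ _ hx hy => rw [End.add_apply, hx, hy, add_zero]
  | neg x _ hx => rw [End.neg_apply, hx, neg_zero]

namespace CovRep

variable {B C : Type*} [NonUnitalRing B] [NonUnitalRing C]

theorem piHom_mem (hFS : ψ.FS) (V : CovRep ψ B) (Θ : ψ.finiteRank) :
    (Θ.1, V.piHom hFS Θ) ∈ V.piGraph :=
  (V.piGraph_total Θ).choose_spec

theorem piHom_mul_T (hFS : ψ.FS) (V : CovRep ψ B) (Θ : ψ.finiteRank) (q : Q) :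
    V.piHom hFS Θ * V.T q = V.T (Θ.1 q) :=
  V.piGraph_mul_T (V.piHom_mem hFS Θ) q

/-- `π_{T,S}` takes values in the additive span of `T(Q) S(P)`. -/
theorem piHom_induction (hFS : ψ.FS) (V : CovRep ψ B) {C : B → Prop}
    (mul : ∀ q p, C (V.T q * V.S p)) (zero : C 0) (add : ∀ x y, C x → C y → C (x + y))
    (neg : ∀ x, C x → C (-x)) (Θ : ψ.finiteRank) : C (V.piHom hFS Θ) := by
  have key : ∀ x ∈ V.piGraph, C x.2 := by
    intro x hx
    induction hx using AddSubgroup.closure_induction with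
    | mem x hx =>
      obtain ⟨q, p, rfl⟩ := hx
      exact mul q p
    | zero => exact zero
    | add x y _ _ hx hy => exact add _ _ hx hy
    | neg x _ hx => exact neg _ hx
  exact key _ (V.piHom_mem hFS Θ)

/-- `η` maps the graph of one `π` into the graph of the other, and under (FS) such a graph is
single-valued. -/
theorem Intertwines.map_piHom (hFS : ψ.FS) {V : CovRep ψ B} {W : CovRep ψ C} {η : B →ₙ+* C}
    (h : V.Intertwines W η) (Θ : ψ.finiteRank) : η (V.piHom hFS Θ) = W.piHom hFS Θ := by
  have key : ∀ x ∈ V.piGraph, (x.1, η x.2) ∈ W.piGraph := by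
    intro x hx
    induction hx using AddSubgroup.closure_induction with
    | mem x hx =>
      obtain ⟨q, p, rfl⟩ := hx
      refine AddSubgroup.subset_closure ⟨q, p, ?_⟩
      simp only [map_mul, h.1 q, h.2.1 p]
    | zero => simp only [Prod.fst_zero, Prod.snd_zero, map_zero]; exact zero_mem W.piGraph
    | add x y _ _ hx hy => simpa using add_mem hx hy
    | neg x _ hx => simpa using neg_mem hx
  exact W.piGraph_unique hFS (key _ (V.piHom_mem hFS Θ)) (W.piHom_mem hFS Θ)

theorem intertwines_comp (V : CovRep ψ B) (φ : B →ₙ+* C) : V.Intertwines (V.comp φ) φ :=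
  ⟨fun _ => rfl, fun _ => rfl, fun _ => rfl⟩

theorem CPInvariant.of_intertwines {hFS : ψ.FS} {V : CovRep ψ B} {W : CovRep ψ C}
    {η : B →ₙ+* C} {J : TwoSidedIdeal R} {hJ : ψ.Compatible J} (hV : V.CPInvariant hFS J hJ)
    (h : V.Intertwines W η) : W.CPInvariant hFS J hJ := fun x hx => by
  rw [← h.map_piHom hFS, hV x hx, h.2.2]

theorem Surjective.of_intertwines {V : CovRep ψ B} {W : CovRep ψ C} {η : B →ₙ+* C}
    (hV : V.Surjective) (hη : Function.Surjective η) (hi : V.Intertwines W η) : W.Surjective := by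
  rw [Surjective, eq_top_iff]
  have h : NonUnitalSubring.closure (Set.range V.σ ∪ Set.range V.T ∪ Set.range V.S) ≤
      (NonUnitalSubring.closure (Set.range W.σ ∪ Set.range W.T ∪ Set.range W.S)).comap η := by
    refine NonUnitalSubring.closure_le.2 ?_
    rintro _ ((⟨r, rfl⟩ | ⟨q, rfl⟩) | ⟨p, rfl⟩)
    · exact NonUnitalSubring.subset_closure (.inl (.inl ⟨r, (hi.2.2 r).symm⟩))
    · exact NonUnitalSubring.subset_closure (.inl (.inr ⟨q, (hi.1 q).symm⟩))
    · exact NonUnitalSubring.subset_closure (.inr ⟨p, (hi.2.1 p).symm⟩)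
  rw [hV] at h
  intro c _
  obtain ⟨b, rfl⟩ := hη c
  exact h (NonUnitalSubring.mem_top b)

/-- Intertwiners out of a surjective representation are unique. -/
theorem Intertwines.unique {V : CovRep ψ B} (hV : V.Surjective) {W : CovRep ψ C}
    {η η' : B →ₙ+* C} (h : V.Intertwines W η) (h' : V.Intertwines W η') : η = η' := by
  ext x
  refine NonUnitalRingHom.eqOn_set_closure
    (s := Set.range V.σ ∪ Set.range V.T ∪ Set.range V.S) ?_ ?_
  · rintro _ ((⟨r, rfl⟩ | ⟨q, rfl⟩) | ⟨p, rfl⟩)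
    · rw [h.2.2, h'.2.2]
    · rw [h.1, h'.1]
    · rw [h.2.1, h'.2.1]
  · rw [show NonUnitalSubring.closure _ = ⊤ from hV]
    exact NonUnitalSubring.mem_top x

theorem Surjective.surjective_of_intertwines {V : CovRep ψ B} {W : CovRep ψ C} {η : B →ₙ+* C}
    (h : V.Intertwines W η) (hW : W.Surjective) : Function.Surjective η := by
  intro c
  have hle : NonUnitalSubring.closure (Set.range W.σ ∪ Set.range W.T ∪ Set.range W.S) ≤
      η.range := by
    refine NonUnitalSubring.closure_le.2 ?_
    rintro _ ((⟨r, rfl⟩ | ⟨q, rfl⟩) | ⟨p, rfl⟩)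
    · exact ⟨V.σ r, h.2.2 r⟩
    · exact ⟨V.T q, h.1 q⟩
    · exact ⟨V.S p, h.2.1 p⟩
  rw [hW] at hle
  exact hle (NonUnitalSubring.mem_top c)

end CovRep

/-! ### The universal properties -/

/-- The quotient map from the free ring onto the Toeplitz ring, as a ring homomorphism. -/
noncomputable def Toeplitz.mkHom (ψ : SystemMap R P Q) :
    FreeNURing (Gen R P Q) →ₙ+* Toeplitz ψ where
  toFun := Toeplitz.mk ψ
  map_mul' _ _ := rfl
  map_zero' := rfl
  map_add' _ _ := rfl

theorem Toeplitz.mk_surjective (ψ : SystemMap R P Q) : Function.Surjective (Toeplitz.mk ψ) :=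
  Quotient.mk_surjective

theorem FreeNURing.closure_of (X : Type*) :
    NonUnitalSubring.closure (Set.range (FreeNURing.of (X := X))) = ⊤ := by
  refine eq_top_iff.2 fun x _ => ?_
  have hw : ∀ w : FreeSemigroup X, (MonoidAlgebra.single w 1 : FreeNURing X) ∈
      NonUnitalSubring.closure (Set.range (FreeNURing.of (X := X))) := by
    intro w
    induction w using FreeSemigroup.recOnMul with
    | ih1 x => exact NonUnitalSubring.subset_closure ⟨x, rfl⟩
    | ih2 x y hx hy =>
      have := mul_mem hx hy
      rwa [MonoidAlgebra.single_mul_single, mul_one] at this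
  induction x using MonoidAlgebra.induction_linear with
  | zero => exact zero_mem _
  | add x y hx hy => exact add_mem (hx trivial) (hy trivial)
  | single w n =>
    have := zsmul_mem (hw w) n
    rwa [MonoidAlgebra.smul_single, smul_eq_mul, mul_one] at this

theorem toeplitzRep_surjective (ψ : SystemMap R P Q) : (toeplitzRep ψ).Surjective := by
  refine eq_top_iff.2 fun x _ => ?_
  obtain ⟨x, rfl⟩ := Toeplitz.mk_surjective ψ x
  have h : NonUnitalSubring.closure (Set.range (FreeNURing.of (X := Gen R P Q))) ≤
      (NonUnitalSubring.closure (Set.range (toeplitzRep ψ).σ ∪ Set.range (toeplitzRep ψ).T ∪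
        Set.range (toeplitzRep ψ).S)).comap (Toeplitz.mkHom ψ) := by
    refine NonUnitalSubring.closure_le.2 ?_
    rintro _ ⟨r | q | p, rfl⟩
    · exact NonUnitalSubring.subset_closure (.inl (.inl ⟨r, rfl⟩))
    · exact NonUnitalSubring.subset_closure (.inl (.inr ⟨q, rfl⟩))
    · exact NonUnitalSubring.subset_closure (.inr ⟨p, rfl⟩)
  rw [FreeNURing.closure_of] at h
  exact h (NonUnitalSubring.mem_top x)

variable {B : Type*} [NonUnitalRing B]

/-- The value of a covariant representation on a generator of the Toeplitz ring. -/
def CovRep.gen (V : CovRep ψ B) : Gen R P Q → B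
  | .r r => V.σ r
  | .q q => V.T q
  | .p p => V.S p

/-- The map on the free ring induced by a covariant representation. -/
noncomputable def CovRep.freeLift (V : CovRep ψ B) : FreeNURing (Gen R P Q) →ₙ+* B :=
  (MonoidAlgebra.liftMagma ℤ (FreeSemigroup.lift V.gen) : _ →ₙₐ[ℤ] B)

theorem CovRep.freeLift_of (V : CovRep ψ B) (x : Gen R P Q) :
    V.freeLift (.of x) = V.gen x := by
  change MonoidAlgebra.liftMagma ℤ (FreeSemigroup.lift V.gen) (MonoidAlgebra.single _ 1) = _
  simp [MonoidAlgebra.liftMagma]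

theorem CovRep.freeLift_eq (V : CovRep ψ B) {x y : FreeNURing (Gen R P Q)}
    (h : ringConGen (ToeplitzRel ψ) x y) : V.freeLift x = V.freeLift y := by
  induction h with
  | of x y h =>
    cases h <;>
    simp only [map_add, map_mul, freeLift_of, gen, V.S_rsmul, V.S_lsmul, V.T_rsmul, V.T_lsmul,
      V.σ_pair]
  | refl => rfl
  | symm _ h => exact h.symm
  | trans _ _ h h' => exact h.trans h'
  | add _ _ h h' => rw [map_add, map_add, h, h']
  | mul _ _ h h' => rw [map_mul, map_mul, h, h']

/-- The homomorphism out of the Toeplitz ring induced by a covariant representation. -/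
noncomputable def CovRep.toeplitzLift (V : CovRep ψ B) : Toeplitz ψ →ₙ+* B where
  toFun := Quotient.lift V.freeLift fun _ _ h => V.freeLift_eq h
  map_mul' := by
    rintro ⟨x⟩ ⟨y⟩
    exact map_mul V.freeLift x y
  map_zero' := map_zero V.freeLift
  map_add' := by
    rintro ⟨x⟩ ⟨y⟩
    exact map_add V.freeLift x y

theorem CovRep.toeplitzLift_intertwines (V : CovRep ψ B) :
    (toeplitzRep ψ).Intertwines V V.toeplitzLift :=
  ⟨fun q => V.freeLift_of (.q q), fun p => V.freeLift_of (.p p), fun r => V.freeLift_of (.r r)⟩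

section Relative

variable {hFS : ψ.FS} {J : TwoSidedIdeal R} {hJ : ψ.Compatible J}

theorem rho_surjective (hFS : ψ.FS) (J : TwoSidedIdeal R) (hJ : ψ.Compatible J) :
    Function.Surjective (rho hFS J hJ) :=
  Quotient.mk_surjective

theorem relCPRep_surjective (hFS : ψ.FS) (J : TwoSidedIdeal R) (hJ : ψ.Compatible J) :
    (relCPRep hFS J hJ).Surjective :=
  (toeplitzRep_surjective ψ).of_intertwines (rho_surjective hFS J hJ)
    ((toeplitzRep ψ).intertwines_comp _)

theorem rho_eq_zero_iff {x : Toeplitz ψ} :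
    rho hFS J hJ x = 0 ↔ x ∈ toeplitzIdeal hFS J hJ := by
  rw [TwoSidedIdeal.mem_iff]
  exact RingCon.eq _

theorem relCPRep_piHom (Θ : ψ.finiteRank) :
    (relCPRep hFS J hJ).piHom hFS Θ = rho hFS J hJ ((toeplitzRep ψ).piHom hFS Θ) :=
  (((toeplitzRep ψ).intertwines_comp (rho hFS J hJ)).map_piHom hFS Θ).symm

theorem relCPRep_CPInvariant (hFS : ψ.FS) (J : TwoSidedIdeal R) (hJ : ψ.Compatible J) :
    (relCPRep hFS J hJ).CPInvariant hFS J hJ := by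
  intro x hx
  rw [relCPRep_piHom, eq_comm, ← sub_eq_zero]
  change rho hFS J hJ ((toeplitzRep ψ).σ x) - _ = 0
  rw [← map_sub, rho_eq_zero_iff]
  exact TwoSidedIdeal.subset_span ⟨x, hx, rfl⟩

theorem CovRep.CPInvariant.toeplitzLift_eq_zero {V : CovRep ψ B} (hV : V.CPInvariant hFS J hJ)
    {x : Toeplitz ψ} (hx : x ∈ toeplitzIdeal hFS J hJ) : V.toeplitzLift x = 0 := by
  have h : toeplitzIdeal hFS J hJ ≤ TwoSidedIdeal.ker V.toeplitzLift := by
    refine TwoSidedIdeal.span_le.2 ?_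
    rintro _ ⟨x, hx, rfl⟩
    rw [SetLike.mem_coe, TwoSidedIdeal.mem_ker, map_sub,
      V.toeplitzLift_intertwines.map_piHom hFS, V.toeplitzLift_intertwines.2.2, hV x hx, sub_self]
  exact (TwoSidedIdeal.mem_ker _).1 (h hx)

/-- The homomorphism out of the relative Cuntz-Pimsner ring induced by an invariant
representation. -/
noncomputable def CovRep.CPInvariant.lift {V : CovRep ψ B} (hV : V.CPInvariant hFS J hJ) :
    RelCP hFS J hJ →ₙ+* B where
  toFun := Quotient.lift V.toeplitzLift fun x y h => by
    rw [← sub_eq_zero, ← map_sub]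
    exact hV.toeplitzLift_eq_zero ((TwoSidedIdeal.rel_iff _ _ _).1 h)
  map_mul' := by
    rintro ⟨x⟩ ⟨y⟩
    exact map_mul V.toeplitzLift x y
  map_zero' := map_zero V.toeplitzLift
  map_add' := by
    rintro ⟨x⟩ ⟨y⟩
    exact map_add V.toeplitzLift x y

theorem CovRep.CPInvariant.lift_intertwines {V : CovRep ψ B} (hV : V.CPInvariant hFS J hJ) :
    (relCPRep hFS J hJ).Intertwines V hV.lift :=
  V.toeplitzLift_intertwines

end Relative

end CuntzPimsner

/-! ### Unitization, Laurent polynomials and the grading -/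

namespace CuntzPimsner

/-- The unitization of a ring `B`. -/
def Unital (B : Type*) [NonUnitalRing B] : Type _ := Unitization ℤ B

namespace Unital

variable {B : Type*} [NonUnitalRing B]

noncomputable instance : Ring (Unital B) := inferInstanceAs (Ring (Unitization ℤ B))

/-- The embedding of a ring into its unitization. -/
noncomputable def inr : B →ₙ+* Unital B where
  toFun b := (b : Unitization ℤ B)
  map_mul' := Unitization.inr_mul ℤ
  map_zero' := Unitization.inr_zero ℤ
  map_add' := Unitization.inr_add ℤ

theorem inr_injective : Function.Injective (inr : B → Unital B) := Unitization.inr_injective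

/-- Shows that a two-sided ideal of `B` absorbs right multiplication by the unitization: both terms
stay in any ideal containing `b`. -/
theorem exists_inr_mul (b : B) (u : Unital B) :
    ∃ (n : ℤ) (c : B), inr b * u = inr (n • b + b * c) :=
  ⟨u.fst, u.snd, by
    apply Unitization.ext
    · exact zero_mul u.fst
    · change (0 : ℤ) • u.snd + u.fst • b + b * u.snd = u.fst • b + b * u.snd
      rw [zero_smul, zero_add]⟩

end Unital

end CuntzPimsner

namespace CuntzPimsner

variable {R P Q : Type*} [NonUnitalRing R] [AddCommGroup P] [AddCommGroup Q]
  [Bimodule R P] [Bimodule R Q] {ψ : SystemMap R P Q}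

namespace CovRep

variable {B : Type*} [NonUnitalRing B]

/-- The monomial `b tⁿ` in the Laurent polynomial ring over the unitization of `B`. -/
noncomputable def monomial (n : ℤ) : B →+ AddMonoidAlgebra (Unital B) ℤ where
  toFun b := AddMonoidAlgebra.single n (Unital.inr b)
  map_zero' := by simp
  map_add' := by simp

theorem monomial_mul (m n : ℤ) (a b : B) :
    monomial m a * monomial n b = monomial (m + n) (a * b) := by
  change AddMonoidAlgebra.single m (Unital.inr a) * AddMonoidAlgebra.single n (Unital.inr b) = _
  rw [AddMonoidAlgebra.single_mul_single, ← map_mul]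
  rfl

theorem sum_monomial_eq_zero {s : Finset ℤ} {f : ℤ → B} (h : ∑ n ∈ s, monomial n (f n) = 0)
    {n : ℤ} (hn : n ∈ s) : f n = 0 := by
  classical
  have h' := congrArg (fun x : AddMonoidAlgebra (Unital B) ℤ => x.coeff n) h
  have h'' : ∑ m ∈ s, (if m = n then Unital.inr (f m) else 0) = 0 := by
    refine Eq.trans ?_ h'
    rw [AddMonoidAlgebra.coeff_sum, Finsupp.finsetSum_apply]
    exact Finset.sum_congr rfl fun m _ => (Finsupp.single_apply).symm
  rw [Finset.sum_ite_eq' s n, if_pos hn] at h''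
  exact Unital.inr_injective (h''.trans (map_zero _).symm)

/-- The representation `(S t⁻¹, T t, σ)` on the Laurent polynomial ring. -/
noncomputable def laurent (V : CovRep ψ B) :
    CovRep ψ (AddMonoidAlgebra (Unital B) ℤ) where
  S := (monomial (-1)).comp V.S
  T := (monomial 1).comp V.T
  σ := { (monomial 0).comp (V.σ : R →+ B) with
    map_mul' := fun r r' => by
      change monomial 0 (V.σ (r * r')) = monomial 0 (V.σ r) * monomial 0 (V.σ r')
      rw [monomial_mul, map_mul, add_zero] }
  S_rsmul p r := by
    change monomial _ (V.S (p <• r)) = monomial _ (V.S p) * monomial _ (V.σ r)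
    rw [monomial_mul, V.S_rsmul, add_zero]
  S_lsmul r p := by
    change monomial _ (V.S (r • p)) = monomial _ (V.σ r) * monomial _ (V.S p)
    rw [monomial_mul, V.S_lsmul, zero_add]
  T_rsmul q r := by
    change monomial _ (V.T (q <• r)) = monomial _ (V.T q) * monomial _ (V.σ r)
    rw [monomial_mul, V.T_rsmul, add_zero]
  T_lsmul r q := by
    change monomial _ (V.T (r • q)) = monomial _ (V.σ r) * monomial _ (V.T q)
    rw [monomial_mul, V.T_lsmul, zero_add]
  σ_pair p q := by
    change monomial _ (V.σ (ψ.pair p q)) = monomial _ (V.S p) * monomial _ (V.T q)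
    rw [monomial_mul, V.σ_pair, neg_add_cancel]

/-- The factors `t` and `t⁻¹` cancel in `T(q) t · S(p) t⁻¹`, so the twist leaves `π` unchanged,
placed in degree zero. -/
theorem laurent_piGraph (V : CovRep ψ B) {x : AddMonoid.End Q × B} (hx : x ∈ V.piGraph) :
    (x.1, monomial 0 x.2) ∈ V.laurent.piGraph := by
  induction hx using AddSubgroup.closure_induction with
  | mem x hx =>
    obtain ⟨q, p, rfl⟩ := hx
    refine AddSubgroup.subset_closure ⟨q, p, Prod.ext rfl ?_⟩
    change _ = monomial _ (V.T q) * monomial _ (V.S p)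
    rw [monomial_mul, add_neg_cancel]
  | zero => simp only [Prod.fst_zero, Prod.snd_zero, map_zero]; exact zero_mem V.laurent.piGraph
  | add x y _ _ hx hy => simpa using add_mem hx hy
  | neg x _ hx => simpa using neg_mem hx

theorem CPInvariant.laurent {hFS : ψ.FS} {J : TwoSidedIdeal R} {hJ : ψ.Compatible J}
    {V : CovRep ψ B} (hV : V.CPInvariant hFS J hJ) : V.laurent.CPInvariant hFS J hJ := by
  intro x hx
  refine V.laurent.piGraph_unique hFS (V.laurent.piHom_mem hFS _)
    (c := monomial 0 (V.σ x)) ?_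
  rw [← hV x hx]
  exact V.laurent_piGraph (V.piHom_mem hFS ⟨lmul R Q x, hJ x hx⟩)

/-- A surjective representation on `B` is graded as soon as `B` has a gauge coaction. -/
theorem Surjective.graded {V : CovRep ψ B} (hV : V.Surjective)
    {δ : B →ₙ+* AddMonoidAlgebra (Unital B) ℤ} (hδ : V.Intertwines V.laurent δ) :
    V.Graded := by
  classical
  -- Eigenspaces of the coaction serve as the grading: the generators lie in them, degrees add under
  -- products, and Laurent coefficients separate them.
  let 𝒜 : ℤ → AddSubgroup B := fun n => ((δ : B →+ _) - monomial n).ker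
  have mem𝒜 : ∀ n x, x ∈ 𝒜 n ↔ δ x = monomial n x := fun n x => by
    rw [AddMonoidHom.mem_ker, AddMonoidHom.sub_apply, sub_eq_zero]; rfl
  have hmul : ∀ m n : ℤ, ∀ a ∈ 𝒜 m, ∀ b ∈ 𝒜 n, a * b ∈ 𝒜 (m + n) := fun m n a ha b hb => by
    rw [mem𝒜] at *
    rw [map_mul, ha, hb, monomial_mul]
  have hσ : ∀ r, V.σ r ∈ 𝒜 0 := fun r => (mem𝒜 _ _).2 (hδ.2.2 r)
  have hT : ∀ q, V.T q ∈ 𝒜 1 := fun q => (mem𝒜 _ _).2 (hδ.1 q)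
  have hS : ∀ p, V.S p ∈ 𝒜 (-1) := fun p => (mem𝒜 _ _).2 (hδ.2.1 p)
  refine ⟨𝒜, ⟨?_, ?_⟩, hmul, hσ, hT, hS⟩
  -- Under `δ`, a vanishing sum of homogeneous elements becomes a zero Laurent polynomial whose
  -- coefficients are the summands.
  · rw [injective_iff_map_eq_zero]
    intro f hf
    have hsum : ∑ n ∈ DFinsupp.support f, (f n : B) = 0 := by
      rw [DirectSum.coeAddMonoidHom_eq_dfinsuppSum] at hf
      exact hf
    have := congrArg δ hsum
    rw [map_sum, map_zero, Finset.sum_congr rfl fun n _ => (mem𝒜 n _).1 (f n).2] at this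
    ext n
    by_cases hn : n ∈ DFinsupp.support f
    · exact sum_monomial_eq_zero this hn
    · rw [DFinsupp.notMem_support_iff.1 hn]
      rfl
  · intro x
    have hx : x ∈ NonUnitalSubring.closure (Set.range V.σ ∪ Set.range V.T ∪ Set.range V.S) := by
      rw [show NonUnitalSubring.closure _ = ⊤ from hV]
      exact NonUnitalSubring.mem_top x
    have of : ∀ n, ∀ a ∈ 𝒜 n, a ∈ (DirectSum.coeAddMonoidHom 𝒜).range := fun n a ha =>
      ⟨DirectSum.of (fun n => 𝒜 n) n ⟨a, ha⟩, DirectSum.coeAddMonoidHom_of _ _ _⟩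
    change x ∈ (DirectSum.coeAddMonoidHom 𝒜).range
    induction hx using NonUnitalSubring.closure_induction with
    | mem x hx =>
      obtain (⟨r, rfl⟩ | ⟨q, rfl⟩) | ⟨p, rfl⟩ := hx
      exacts [of _ _ (hσ r), of _ _ (hT q), of _ _ (hS p)]
    | zero => exact zero_mem _
    | add x y _ _ hx hy => exact add_mem hx hy
    | neg x _ hx => exact neg_mem hx
    | mul x y _ _ hx hy =>
      obtain ⟨f, rfl⟩ := hx
      obtain ⟨g, rfl⟩ := hy
      clear * - of hmul
      induction f using DirectSum.induction_on with
      | zero => rw [map_zero, zero_mul]; exact zero_mem _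
      | add f f' hf hf' => rw [map_add, add_mul]; exact add_mem hf hf'
      | of m a =>
        induction g using DirectSum.induction_on with
        | zero => rw [map_zero, mul_zero]; exact zero_mem _
        | add f f' hf hf' => rw [map_add, mul_add]; exact add_mem hf hf'
        | of n b =>
          rw [DirectSum.coeAddMonoidHom_of, DirectSum.coeAddMonoidHom_of]
          exact of _ _ (hmul m n _ a.2 _ b.2)

end CovRep

/-- A representation isomorphic to a relative Cuntz-Pimsner representation is graded. -/
theorem CovRep.graded_of_bijective {B : Type*} [NonUnitalRing B] {hFS : ψ.FS}
    {J : TwoSidedIdeal R} {hJ : ψ.Compatible J} {V : CovRep ψ B} {η : RelCP hFS J hJ →ₙ+* B}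
    (hV : V.CPInvariant hFS J hJ) (hη : (relCPRep hFS J hJ).Intertwines V η)
    (hb : Function.Bijective η) : V.Graded := by
  let e : RelCP hFS J hJ ≃+* B := RingEquiv.ofBijective η hb
  have he : ∀ x, e.symm (η x) = x := e.symm_apply_apply
  -- The Laurent twist of `V` is invariant, hence factors through `𝓞(J)`; precomposing with the
  -- inverse of `η` makes it a coaction on `B`.
  refine ((relCPRep_surjective hFS J hJ).of_intertwines hb.2 hη).graded
    (δ := hV.laurent.lift.comp (e.symm : B →ₙ+* RelCP hFS J hJ)) ?_
  have h := hV.laurent.lift_intertwines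
  refine ⟨fun q => ?_, fun p => ?_, fun r => ?_⟩
  · rw [← h.1, ← hη.1]; exact congrArg _ (he _)
  · rw [← h.2.1, ← hη.2.1]; exact congrArg _ (he _)
  · rw [← h.2.2, ← hη.2.2]; exact congrArg _ (he _)

end CuntzPimsner

namespace CuntzPimsner

variable {R P Q : Type*} [NonUnitalRing R] [AddCommGroup P] [AddCommGroup Q]
  [Bimodule R P] [Bimodule R Q] {ψ : SystemMap R P Q}

/-! ### The Fock representation

The Toeplitz ring is represented on the module of families of additive, `R`-balanced maps
`P ⊗ ⋯ ⊗ P → R₁`, where `R₁` is the unitization of `R`; such a family is a function on lists. -/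

/-- The action of `r` on functions on lists: on the first entry from the right, and on the value
at the empty list from the left. -/
noncomputable def listAct (r : R) (f : List P → Unital R) : List P → Unital R
  | [] => Unital.inr r * f []
  | p :: l => f ((p <• r) :: l)

theorem listAct_add_right (r : R) (f g : List P → Unital R) :
    listAct r (f + g) = listAct r f + listAct r g := by
  funext l
  cases l <;> simp [listAct, mul_add]

theorem listAct_zero (r : R) : listAct r (0 : List P → Unital R) = 0 := by
  funext l
  cases l <;> simp [listAct]

theorem listAct_mul (r s : R) (f : List P → Unital R) :
    listAct (r * s) f = listAct r (listAct s f) := by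
  funext l
  cases l with
  | nil => simp only [listAct, map_mul, mul_assoc]
  | cons p l => simp only [listAct, Bimodule.mul_rsmul]

variable (R P) in
/-- The module of additive and `R`-balanced functions on lists. -/
noncomputable def Fock : AddSubgroup (List P → Unital R) where
  carrier := {f | (∀ l p p' l', f (l ++ (p + p') :: l') = f (l ++ p :: l') + f (l ++ p' :: l')) ∧
    ∀ l (r : R) p l', f (l ++ (r • p) :: l') = listAct r (fun x => f (l ++ p :: x)) l'}
  zero_mem' := ⟨by simp, fun l r p l' => (congrFun (listAct_zero r) l').symm⟩
  add_mem' := by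
    rintro f g ⟨hf, hf'⟩ ⟨hg, hg'⟩
    refine ⟨fun l p p' l' => ?_, fun l r p l' => ?_⟩
    · simp only [Pi.add_apply, hf, hg]; abel
    · simp only [Pi.add_apply, hf', hg']
      exact (congrFun (listAct_add_right r _ _) l').symm
  neg_mem' := by
    rintro f ⟨hf, hf'⟩
    refine ⟨fun l p p' l' => ?_, fun l r p l' => ?_⟩
    · simp only [Pi.neg_apply, hf]; abel
    · simp only [Pi.neg_apply, hf']
      cases l' <;> simp [listAct]

theorem SystemMap.pair_rsmul_left (ψ : SystemMap R P Q) (p : P) (r : R) (q : Q) :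
    ψ.pair (p <• r) q = ψ.pair p (r • q) :=
  congrArg _ (BalancedTensor.rsmul_tmul p r q)

namespace Fock

theorem map_add_cons (f : Fock R P) (p p' : P) (l : List P) :
    f.1 ((p + p') :: l) = f.1 (p :: l) + f.1 (p' :: l) := f.2.1 [] p p' l

theorem map_smul_cons (f : Fock R P) (r : R) (p : P) (l : List P) :
    f.1 ((r • p) :: l) = listAct r (fun x => f.1 (p :: x)) l := f.2.2 [] r p l

/-- The balancing relation survives because the left and right actions on `P` commute; only the
first letter needs attention. -/
theorem listAct_mem (r : R) {f : List P → Unital R} (hf : f ∈ Fock R P) :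
    listAct r f ∈ Fock R P := by
  refine ⟨fun l p p' l' => ?_, fun l s p l' => ?_⟩
  · cases l with
    | nil =>
      simp only [List.nil_append, listAct, Bimodule.rsmul_add]
      exact hf.1 [] _ _ _
    | cons p₀ l => exact hf.1 ((p₀ <• r) :: l) _ _ _
  · cases l with
    | nil =>
      simp only [List.nil_append, listAct, Bimodule.lsmul_rsmul]
      exact hf.2 [] _ _ _
    | cons p₀ l => exact hf.2 ((p₀ <• r) :: l) _ _ _

theorem listAct_add_left (r s : R) (f : Fock R P) :
    listAct (r + s) f.1 = listAct r f.1 + listAct s f.1 := by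
  funext l
  cases l with
  | nil => simp only [listAct, Pi.add_apply, map_add, add_mul]
  | cons p l => simp only [listAct, Pi.add_apply, Bimodule.add_rsmul, map_add_cons]

/-- The action of `r` on the Fock module. -/
noncomputable def act (r : R) : AddMonoid.End (Fock R P) :=
  AddMonoidHom.mk' (fun f => ⟨listAct r f.1, listAct_mem r f.2⟩)
    fun f g => Subtype.ext (listAct_add_right r f.1 g.1)

/-- The annihilation operator attached to `p`. -/
noncomputable def annihilate (p : P) : AddMonoid.End (Fock R P) :=
  AddMonoidHom.mk' (fun f => ⟨fun l => f.1 (p :: l),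
    fun l => f.2.1 (p :: l), fun l => f.2.2 (p :: l)⟩) fun _ _ => rfl

/-- The function underlying the creation operator attached to `q`. -/
noncomputable def createFun (ψ : SystemMap R P Q) (q : Q) (f : List P → Unital R) :
    List P → Unital R
  | [] => 0
  | p :: l => listAct (ψ.pair p q) f l

/-- At the first letter the relation is `ψ(sp ⊗ q) = s ψ(p ⊗ q)`; at later letters it is inherited
from `listAct_mem`. -/
theorem createFun_mem (q : Q) (f : Fock R P) : createFun ψ q f.1 ∈ Fock R P := by
  refine ⟨fun l p p' l' => ?_, fun l s p l' => ?_⟩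
  · cases l with
    | nil =>
      simp only [List.nil_append, createFun, SystemMap.pair_add_left, listAct_add_left]
      rfl
    | cons p₀ l => exact (listAct_mem (ψ.pair p₀ q) f.2).1 l _ _ _
  · cases l with
    | nil =>
      simp only [List.nil_append, createFun, SystemMap.pair_lsmul, listAct_mul]
    | cons p₀ l => exact (listAct_mem (ψ.pair p₀ q) f.2).2 l _ _ _

/-- The creation operator attached to `q`. -/
noncomputable def create (ψ : SystemMap R P Q) (q : Q) : AddMonoid.End (Fock R P) :=
  AddMonoidHom.mk' (fun f => ⟨createFun ψ q f.1, createFun_mem q f⟩) fun f g => Subtype.ext <| by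
    funext l
    cases l with
    | nil => exact (add_zero 0).symm
    | cons p l => exact congrFun (listAct_add_right (ψ.pair p q) f.1 g.1) l

theorem end_ext {A A' : AddMonoid.End (Fock R P)} (h : ∀ f l, (A f).1 l = (A' f).1 l) : A = A' :=
  AddMonoidHom.ext fun f => Subtype.ext (funext (h f))

theorem act_apply (r : R) (f : Fock R P) (l : List P) : (act r f).1 l = listAct r f.1 l := rfl

theorem create_apply_nil (q : Q) (f : Fock R P) : (create ψ q f).1 [] = 0 := rfl

theorem create_apply_cons (q : Q) (f : Fock R P) (p : P) (l : List P) :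
    (create ψ q f).1 (p :: l) = listAct (ψ.pair p q) f.1 l := rfl

theorem add_apply (A A' : AddMonoid.End (Fock R P)) (f : Fock R P) (l : List P) :
    ((A + A') f).1 l = (A f).1 l + (A' f).1 l := rfl

theorem act_add (r s : R) : (act (r + s) : AddMonoid.End (Fock R P)) = act r + act s :=
  end_ext fun f l => by
    rw [add_apply, act_apply, act_apply, act_apply, listAct_add_left, Pi.add_apply]

theorem act_mul (r s : R) : (act (r * s) : AddMonoid.End (Fock R P)) = act r * act s :=
  end_ext fun f l => congrFun (listAct_mul r s f.1) l

theorem act_zero : (act (0 : R) : AddMonoid.End (Fock R P)) = 0 := by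
  have h := act_add (P := P) (0 : R) 0
  rwa [add_zero, left_eq_add] at h

/-- The action of `R` on the Fock module, as a ring homomorphism. -/
noncomputable def actHom : R →ₙ+* AddMonoid.End (Fock R P) where
  toFun := act
  map_mul' := act_mul
  map_zero' := act_zero
  map_add' := act_add

theorem annihilate_add (p p' : P) :
    (annihilate (p + p') : AddMonoid.End (Fock R P)) = annihilate p + annihilate p' :=
  end_ext fun f l => map_add_cons f p p' l

theorem create_add (q q' : Q) : create ψ (q + q') = create ψ q + create ψ q' :=
  end_ext fun f l => by
    rw [add_apply]
    cases l with
    | nil => rw [create_apply_nil, create_apply_nil, create_apply_nil, add_zero]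
    | cons p l =>
      rw [create_apply_cons, create_apply_cons, create_apply_cons, SystemMap.pair_add_right,
        listAct_add_left, Pi.add_apply]

theorem annihilate_rsmul (p : P) (r : R) :
    (annihilate (p <• r) : AddMonoid.End (Fock R P)) = annihilate p * act r := rfl

theorem annihilate_lsmul (r : R) (p : P) :
    (annihilate (r • p) : AddMonoid.End (Fock R P)) = act r * annihilate p :=
  end_ext fun f l => map_smul_cons f r p l

theorem create_rsmul (q : Q) (r : R) : create ψ (q <• r) = create ψ q * act r :=
  end_ext fun f l => by
    rw [End.mul_apply]
    cases l with
    | nil => rfl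
    | cons p l =>
      rw [create_apply_cons, create_apply_cons, SystemMap.pair_rsmul, listAct_mul]
      rfl

theorem create_lsmul (r : R) (q : Q) : create ψ (r • q) = act r * create ψ q :=
  end_ext fun f l => by
    rw [End.mul_apply, act_apply]
    cases l with
    | nil => exact (mul_zero _).symm
    | cons p l =>
      rw [create_apply_cons, ← SystemMap.pair_rsmul_left]
      rfl

theorem act_pair (p : P) (q : Q) : act (ψ.pair p q) = annihilate p * create ψ q := rfl

end Fock

open Fock

/-- The Fock representation. -/
noncomputable def fockRep (ψ : SystemMap R P Q) : CovRep ψ (AddMonoid.End (Fock R P)) where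
  S := AddMonoidHom.mk' annihilate annihilate_add
  T := AddMonoidHom.mk' (create ψ) create_add
  σ := actHom
  S_rsmul := annihilate_rsmul
  S_lsmul := annihilate_lsmul
  T_rsmul := create_rsmul
  T_lsmul := create_lsmul
  σ_pair := act_pair

/-- The vacuum vector. -/
noncomputable def vacuum : Fock R P :=
  ⟨fun l => match l with
    | [] => 1
    | _ :: _ => 0, by
    refine ⟨fun l p p' l' => ?_, fun l r p l' => ?_⟩
    · cases l <;> simp
    · cases l <;> cases l' <;> simp [listAct]⟩

/-- Outputs of creation operators vanish at the empty list, and `π` takes values in sums of products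
`T(q) S(p)`. -/
theorem fockRep_piHom_nil (hFS : ψ.FS) (Θ : ψ.finiteRank) (f : Fock R P) :
    ((fockRep ψ).piHom hFS Θ f).1 [] = 0 := by
  refine (fockRep ψ).piHom_induction hFS (C := fun A => (A f).1 [] = 0) (fun q p => rfl) rfl
    (fun x y hx hy => ?_) (fun x hx => ?_) Θ
  · exact (congrArg₂ (· + ·) hx hy).trans (add_zero 0)
  · exact (congrArg Neg.neg hx).trans neg_zero

/-- Finite rank operators act on the first entry of a list through the adjoint operator. -/
theorem fockRep_piGraph_cons {x : AddMonoid.End Q × AddMonoid.End (Fock R P)}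
    (hx : x ∈ (fockRep ψ).piGraph) (p : P) :
    ∃ p' : P, (∀ q, ψ.pair p' q = ψ.pair p (x.1 q)) ∧ ∀ f l, (x.2 f).1 (p :: l) = f.1 (p' :: l) := by
  have h0 : ∀ (f : Fock R P) l, f.1 (0 :: l) = 0 := fun f l => by
    simpa using map_add_cons f 0 0 l
  have hneg : ∀ (f : Fock R P) p l, f.1 (-p :: l) = -f.1 (p :: l) := fun f p l => by
    have := map_add_cons f p (-p) l
    rw [add_neg_cancel, h0] at this
    exact (neg_eq_of_add_eq_zero_right this.symm).symm
  have pair_zero : ∀ p, ψ.pair p 0 = 0 := fun p => by simpa using ψ.pair_add_right p 0 0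
  have pair_neg : ∀ p q, ψ.pair p (-q) = -ψ.pair p q := fun p q => by
    have := ψ.pair_add_right p q (-q)
    rw [add_neg_cancel, pair_zero] at this
    exact (neg_eq_of_add_eq_zero_right this.symm).symm
  have pair_zero' : ∀ q, ψ.pair 0 q = 0 := fun q => by simpa using ψ.pair_add_left 0 0 q
  have pair_neg' : ∀ p q, ψ.pair (-p) q = -ψ.pair p q := fun p q => by
    have := ψ.pair_add_left p (-p) q
    rw [add_neg_cancel, pair_zero'] at this
    exact (neg_eq_of_add_eq_zero_right this.symm).symm
  induction hx using AddSubgroup.closure_induction with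
  | mem x hx =>
    obtain ⟨q', p', rfl⟩ := hx
    -- The adjoint of `θ_{q',p'}` is `θ_{p',q'}`, here evaluated at `p`.
    refine ⟨ψ.pair p q' • p', fun q => ?_, fun f l => ?_⟩
    · rw [SystemMap.theta_apply, SystemMap.pair_lsmul, SystemMap.pair_rsmul]
    · exact (map_smul_cons f _ _ _).symm
  | zero => exact ⟨0, fun q => (pair_zero' q).trans (pair_zero p).symm, fun f l => (h0 f l).symm⟩
  | add x y _ _ hx hy =>
    obtain ⟨a, ha, ha'⟩ := hx
    obtain ⟨b, hb, hb'⟩ := hy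
    refine ⟨a + b, fun q => ?_, fun f l => ?_⟩
    · rw [ψ.pair_add_left, ha, hb, ← ψ.pair_add_right]; rfl
    · rw [map_add_cons, ← ha', ← hb']; rfl
  | neg x _ hx =>
    obtain ⟨a, ha, ha'⟩ := hx
    refine ⟨-a, fun q => ?_, fun f l => ?_⟩
    · rw [pair_neg', ha, ← pair_neg]; rfl
    · rw [hneg, ← ha']; rfl

/-- Both operators act through the first letter. The finite rank one replaces `p` by some `p'` with
`ψ(p' ⊗ q) = ψ(p ⊗ rq) = ψ(pr ⊗ q)` for all `q`, and nondegeneracy gives `p' = pr`. -/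
theorem fockRep_piHom_cons (hFS : ψ.FS) {r : R} (hr : lmul R Q r ∈ ψ.finiteRank) (f : Fock R P)
    (p : P) (l : List P) :
    ((fockRep ψ).piHom hFS ⟨lmul R Q r, hr⟩ f).1 (p :: l) = ((fockRep ψ).σ r f).1 (p :: l) := by
  obtain ⟨p', hp', h⟩ := fockRep_piGraph_cons ((fockRep ψ).piHom_mem hFS ⟨lmul R Q r, hr⟩) p
  rw [h]
  have : p' = p <• r := by
    rw [← sub_eq_zero]
    refine hFS.eq_zero_left fun q => ?_
    have h1 := ψ.pair_add_left (p' - p <• r) (p <• r) q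
    rw [sub_add_cancel, hp', SystemMap.pair_rsmul_left] at h1
    exact left_eq_add.1 (h1.trans (add_comm _ _))
  rw [this]
  rfl

/-! ### Functions with values in `J`, word length, and the action of `𝓣(J)` -/

/-- The functions in the Fock module with values in `J`. -/
def fockIn (J : TwoSidedIdeal R) (f : Fock R P) : Prop :=
  ∀ l, ∃ x ∈ J, f.1 l = Unital.inr x

/-- The functions in the Fock module vanishing on lists of length less than `n`. -/
def vanishBelow (n : ℕ) (f : Fock R P) : Prop := ∀ l, l.length < n → f.1 l = 0

theorem toeplitz_induction {C : Toeplitz ψ → Prop} (σ : ∀ r, C ((toeplitzRep ψ).σ r))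
    (T : ∀ q, C ((toeplitzRep ψ).T q)) (S : ∀ p, C ((toeplitzRep ψ).S p)) (zero : C 0)
    (add : ∀ x y, C x → C y → C (x + y)) (neg : ∀ x, C x → C (-x))
    (mul : ∀ x y, C x → C y → C (x * y)) (x : Toeplitz ψ) : C x := by
  have hx : x ∈ NonUnitalSubring.closure (Set.range (toeplitzRep ψ).σ ∪
      Set.range (toeplitzRep ψ).T ∪ Set.range (toeplitzRep ψ).S) := by
    rw [show NonUnitalSubring.closure _ = ⊤ from toeplitzRep_surjective ψ]
    exact NonUnitalSubring.mem_top x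
  induction hx using NonUnitalSubring.closure_induction with
  | mem x hx =>
    obtain (⟨r, rfl⟩ | ⟨q, rfl⟩) | ⟨p, rfl⟩ := hx
    exacts [σ r, T q, S p]
  | zero => exact zero
  | add x y _ _ hx hy => exact add x y hx hy
  | neg x _ hx => exact neg x hx
  | mul x y _ _ hx hy => exact mul x y hx hy

theorem fockIn.add {J : TwoSidedIdeal R} {f g : Fock R P} (hf : fockIn J f) (hg : fockIn J g) :
    fockIn J (f + g) := fun l => by
  obtain ⟨x, hx, hx'⟩ := hf l
  obtain ⟨y, hy, hy'⟩ := hg l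
  refine ⟨x + y, add_mem hx hy, ?_⟩
  rw [map_add, ← hx', ← hy']
  rfl

theorem fockIn.neg {J : TwoSidedIdeal R} {f : Fock R P} (hf : fockIn J f) : fockIn J (-f) :=
  fun l => by
  obtain ⟨x, hx, hx'⟩ := hf l
  refine ⟨-x, neg_mem hx, ?_⟩
  rw [map_neg, ← hx']
  rfl

theorem fockIn_zero (J : TwoSidedIdeal R) : fockIn J (0 : Fock R P) :=
  fun _ => ⟨0, zero_mem _, (map_zero _).symm⟩

theorem fockIn.act {J : TwoSidedIdeal R} {f : Fock R P} (hf : fockIn J f) (r : R) :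
    fockIn J (Fock.act r f) := fun l => by
  cases l with
  | nil =>
    obtain ⟨x, hx, hx'⟩ := hf []
    refine ⟨r * x, J.mul_mem_left _ _ hx, ?_⟩
    rw [map_mul, ← hx']
    rfl
  | cons p l => exact hf _

/-- A generator evaluates `f` at another list, returns zero, or multiplies the value at the empty
list by an element of `R`, which `J` absorbs. -/
theorem fockIn.toeplitz {J : TwoSidedIdeal R} (z : Toeplitz ψ) :
    ∀ {f : Fock R P}, fockIn J f → fockIn J ((fockRep ψ).toeplitzLift z f) := by
  have hL := (fockRep ψ).toeplitzLift_intertwines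
  induction z using toeplitz_induction with
  | σ r => intro f hf; rw [hL.2.2]; exact hf.act r
  | T q =>
    intro f hf l
    rw [hL.1]
    cases l with
    | nil => exact ⟨0, zero_mem _, (map_zero _).symm⟩
    | cons p l => exact hf.act (ψ.pair p q) l
  | S p => intro f hf l; rw [hL.2.1]; exact hf (p :: l)
  | zero => intro f _; rw [map_zero]; exact fockIn_zero J
  | add x y hx hy => intro f hf; rw [map_add]; exact (hx hf).add (hy hf)
  | neg x hx => intro f hf; rw [map_neg]; exact (hx hf).neg
  | mul x y hx hy => intro f hf; rw [map_mul]; exact hx (hy hf)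

theorem vanishBelow.mono {m n : ℕ} (h : m ≤ n) {f : Fock R P} (hf : vanishBelow n f) :
    vanishBelow m f := fun l hl => hf l (hl.trans_le h)

theorem vanishBelow.act {n : ℕ} {f : Fock R P} (hf : vanishBelow n f) (r : R) :
    vanishBelow n (Fock.act r f) := fun l hl => by
  cases l with
  | nil => exact (congrArg _ (hf [] hl)).trans (mul_zero _)
  | cons p l => exact hf _ hl

theorem vanishBelow.create {n : ℕ} {f : Fock R P} (hf : vanishBelow n f) (q : Q) :
    vanishBelow (n + 1) ((fockRep ψ).T q f) := fun l hl => by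
  cases l with
  | nil => rfl
  | cons p l => exact hf.act (ψ.pair p q) l (Nat.lt_of_succ_lt_succ hl)

/-- Only annihilation operators lower the length threshold, each by one; the losses add up under
products. -/
theorem exists_vanishBelow_toeplitz (z : Toeplitz ψ) :
    ∃ k : ℕ, ∀ (n : ℕ) (f : Fock R P), vanishBelow (n + k) f →
      vanishBelow n ((fockRep ψ).toeplitzLift z f) := by
  have hL := (fockRep ψ).toeplitzLift_intertwines
  induction z using toeplitz_induction with
  | σ r => exact ⟨0, fun n f hf => by rw [hL.2.2]; exact hf.act r⟩
  | T q => exact ⟨0, fun n f hf => by rw [hL.1]; exact (hf.create q).mono n.le_succ⟩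
  | S p => exact ⟨1, fun n f hf l hl => by rw [hL.2.1]; exact hf (p :: l) (Nat.succ_lt_succ hl)⟩
  | zero => exact ⟨0, fun n f _ l _ => by rw [map_zero]; rfl⟩
  | add x y hx hy =>
    obtain ⟨j, hj⟩ := hx
    obtain ⟨k, hk⟩ := hy
    refine ⟨max j k, fun n f hf l hl => ?_⟩
    rw [map_add]
    exact (congrArg₂ (· + ·) (hj n f (hf.mono (by omega)) l hl)
      (hk n f (hf.mono (by omega)) l hl)).trans (add_zero 0)
  | neg x hx =>
    obtain ⟨j, hj⟩ := hx
    refine ⟨j, fun n f hf l hl => ?_⟩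
    rw [map_neg]
    exact (congrArg Neg.neg (hj n f hf l hl)).trans neg_zero
  | mul x y hx hy =>
    obtain ⟨j, hj⟩ := hx
    obtain ⟨k, hk⟩ := hy
    refine ⟨j + k, fun n f hf => ?_⟩
    rw [map_mul]
    exact hj n _ (hk (n + j) f (hf.mono (by omega)))

section Ideal

variable {J : TwoSidedIdeal R} (hFS : ψ.FS) (hJ : ψ.Compatible J)

/-- On the Fock module, `ι(x) - π(Δ(x))` is multiplication by `x` on the vacuum component. -/
theorem fockRep_generator_apply {x : R} (hx : x ∈ J) (f : Fock R P) :
    ((fockRep ψ).toeplitzLift ((toeplitzRep ψ).σ x -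
      (toeplitzRep ψ).piHom hFS ⟨lmul R Q x, hJ x hx⟩) f).1 [] = Unital.inr x * f.1 [] ∧
    ∀ p l, ((fockRep ψ).toeplitzLift ((toeplitzRep ψ).σ x -
      (toeplitzRep ψ).piHom hFS ⟨lmul R Q x, hJ x hx⟩) f).1 (p :: l) = 0 := by
  have hL := (fockRep ψ).toeplitzLift_intertwines
  rw [map_sub, hL.2.2, hL.map_piHom hFS]
  constructor
  · exact (congrArg₂ (· - ·) rfl (fockRep_piHom_nil hFS _ f)).trans (sub_zero _)
  · intro p l
    exact (congrArg₂ (· - ·) rfl (fockRep_piHom_cons hFS _ f p l)).trans (sub_self _)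

/-- The Toeplitz elements carrying the whole Fock module into `J`-valued functions form a two-sided
ideal, with `fockIn.toeplitz` giving absorption from the left. A generator of `𝓣(J)` leaves only the
value `x f([])`, which lies in `J`. -/
theorem fockIn_of_mem_toeplitzIdeal {y : Toeplitz ψ} (hy : y ∈ toeplitzIdeal hFS J hJ)
    (f : Fock R P) : fockIn J ((fockRep ψ).toeplitzLift y f) := by
  let I : TwoSidedIdeal (Toeplitz ψ) := TwoSidedIdeal.mk'
    {y | ∀ f, fockIn J ((fockRep ψ).toeplitzLift y f)}
    (fun f => by rw [map_zero]; exact fockIn_zero J)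
    (fun hx hy f => by rw [map_add]; exact (hx f).add (hy f))
    (fun hx f => by rw [map_neg]; exact (hx f).neg)
    (fun hy f => by rw [map_mul]; exact (hy f).toeplitz _)
    (fun hx f => by rw [map_mul]; exact hx _)
  have h : toeplitzIdeal hFS J hJ ≤ I := by
    refine TwoSidedIdeal.span_le.2 ?_
    rintro _ ⟨x, hx, rfl⟩
    refine (TwoSidedIdeal.mem_mk' _ _ _ _ _ _ _).2 fun f l => ?_
    obtain ⟨h1, h2⟩ := fockRep_generator_apply hFS hJ hx f
    cases l with
    | nil =>
      rw [h1]
      obtain ⟨n, c, hc⟩ := Unital.exists_inr_mul x (f.1 [])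
      exact ⟨_, add_mem (zsmul_mem hx n) (J.mul_mem_right _ _ hx), hc⟩
    | cons p l => exact ⟨0, zero_mem _, (h2 p l).trans (map_zero _).symm⟩
  exact (TwoSidedIdeal.mem_mk' _ _ _ _ _ _ _).1 (h hy) f

/-- A generator of `𝓣(J)` sees only the vacuum component, so `n = 1` works for it. Multiplying on
the left keeps the bound; multiplying on the right raises it by the threshold loss of the right
factor. -/
theorem vanishBelow_of_mem_toeplitzIdeal {y : Toeplitz ψ} (hy : y ∈ toeplitzIdeal hFS J hJ) :
    ∃ n, ∀ f : Fock R P, vanishBelow n f → (fockRep ψ).toeplitzLift y f = 0 := by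
  let I : TwoSidedIdeal (Toeplitz ψ) := TwoSidedIdeal.mk'
    {y | ∃ n, ∀ f : Fock R P, vanishBelow n f → (fockRep ψ).toeplitzLift y f = 0}
    ⟨0, fun f _ => by rw [map_zero]; rfl⟩
    (by
      rintro x y ⟨m, hm⟩ ⟨n, hn⟩
      refine ⟨max m n, fun f hf => ?_⟩
      rw [map_add, End.add_apply, hm f (hf.mono (by omega)), hn f (hf.mono (by omega)), add_zero])
    (by
      rintro x ⟨m, hm⟩
      exact ⟨m, fun f hf => by rw [map_neg, End.neg_apply, hm f hf, neg_zero]⟩)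
    (by
      rintro x y ⟨m, hm⟩
      exact ⟨m, fun f hf => by rw [map_mul, End.mul_apply, hm f hf, map_zero]⟩)
    (by
      rintro x y ⟨m, hm⟩
      obtain ⟨k, hk⟩ := exists_vanishBelow_toeplitz y
      exact ⟨m + k, fun f hf => by rw [map_mul, End.mul_apply, hm _ (hk m f hf)]⟩)
  have h : toeplitzIdeal hFS J hJ ≤ I := by
    refine TwoSidedIdeal.span_le.2 ?_
    rintro _ ⟨x, hx, rfl⟩
    refine (TwoSidedIdeal.mem_mk' _ _ _ _ _ _ _).2 ⟨1, fun f hf => Subtype.ext ?_⟩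
    obtain ⟨h1, h2⟩ := fockRep_generator_apply hFS hJ hx f
    funext l
    cases l with
    | nil => rw [h1, hf [] (by simp), mul_zero]; rfl
    | cons p l => exact h2 p l
  have h' := h hy
  rwa [TwoSidedIdeal.mem_mk'] at h'

/-- If `ι_R(r)` lies in the image of `π` in the relative Cuntz-Pimsner ring, then `r ∈ J`. -/
theorem mem_of_relCPRep_eq {r : R} {Θ : ψ.finiteRank}
    (h : (relCPRep hFS J hJ).σ r = (relCPRep hFS J hJ).piHom hFS Θ) : r ∈ J := by
  have hL := (fockRep ψ).toeplitzLift_intertwines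
  rw [relCPRep_piHom, ← sub_eq_zero] at h
  change rho hFS J hJ ((toeplitzRep ψ).σ r) - _ = 0 at h
  rw [← map_sub, rho_eq_zero_iff] at h
  -- Evaluated at the empty list, `σ(r)` sends the vacuum to `r` and `π(Θ)` sends it to zero, so the
  -- value in `J` is `r` itself.
  obtain ⟨x, hx, h⟩ := fockIn_of_mem_toeplitzIdeal hFS hJ h vacuum []
  rw [map_sub, hL.2.2, hL.map_piHom hFS] at h
  have h' : Unital.inr r * 1 = Unital.inr x :=
    (sub_zero _).symm.trans ((congrArg₂ (· - ·) rfl (fockRep_piHom_nil hFS Θ vacuum)).symm.trans h)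
  rw [mul_one] at h'
  rwa [Unital.inr_injective h']

/-- The representation of `R` in the Cuntz-Pimsner ring relative to a faithful ideal is
injective. -/
theorem relCPRep_injective (hf : Faithful Q J) : (relCPRep hFS J hJ).Injective := by
  set W := relCPRep hFS J hJ
  -- Induction on the length bound. For `n = 0` the element `r` kills the vacuum as well, hence is
  -- zero.
  have key : ∀ (n : ℕ) (r : R), W.σ r = 0 →
      (∀ f : Fock R P, vanishBelow n f → Fock.act r f = 0) → r = 0 := by
    intro n
    induction n with
    | zero =>
      intro r _ h
      have h := congrArg (fun f : Fock R P => f.1 []) (h vacuum (fun l hl => by simp at hl))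
      have h' : Unital.inr r * 1 = 0 := h
      rw [mul_one] at h'
      exact Unital.inr_injective (h'.trans (map_zero _).symm)
    | succ n ih =>
      intro r hr h
      -- Since `σ(r) = 0 = π(0)`, `r` lies in `J`, and faithfulness leaves `Δ(r) = 0`. By
      -- nondegeneracy this follows once each `ψ(p ⊗ rq)` vanishes; it satisfies the hypotheses with
      -- `n` because creation by `q` raises the threshold by one.
      refine hf r (mem_of_relCPRep_eq hFS hJ (Θ := 0) (by rw [map_zero]; exact hr)) ?_
      refine AddMonoidHom.ext fun q => hFS.eq_zero_right fun p => ih _ ?_ fun f hf => ?_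
      · change W.σ (ψ.pair p (r • q)) = 0
        rw [W.σ_pair, W.T_lsmul, hr, zero_mul, mul_zero]
      · have h1 := (fockRep ψ).σ_pair p (r • q)
        rw [(fockRep ψ).T_lsmul] at h1
        have h2 := DFunLike.congr_fun h1 f
        refine h2.trans ?_
        rw [End.mul_apply, End.mul_apply]
        exact (congrArg _ (h _ (hf.create q))).trans (map_zero _)
  refine (injective_iff_map_eq_zero W.σ).2 fun r hr => ?_
  have hr' := hr
  change rho hFS J hJ ((toeplitzRep ψ).σ r) = 0 at hr'
  rw [rho_eq_zero_iff] at hr'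
  obtain ⟨n, hn⟩ := vanishBelow_of_mem_toeplitzIdeal hFS hJ hr'
  refine key n r hr fun f hf => ?_
  rw [← hn f hf, (fockRep ψ).toeplitzLift_intertwines.2.2]
  rfl

theorem relCPRep_idealSet : (relCPRep hFS J hJ).idealSet hFS = J := by
  ext r
  constructor
  · rintro ⟨Θ, hΘ⟩
    exact mem_of_relCPRep_eq hFS hJ hΘ.symm
  · intro hr
    exact ⟨_, relCPRep_CPInvariant hFS J hJ r hr⟩

end Ideal

end CuntzPimsner

/-! ### Injective representations and local units -/

namespace CuntzPimsner

variable {R P Q : Type*} [NonUnitalRing R] [AddCommGroup P] [AddCommGroup Q]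
  [Bimodule R P] [Bimodule R Q] {ψ : SystemMap R P Q}

namespace CovRep

variable {B : Type*} [NonUnitalRing B]

theorem Injective.T_injective (hFS : ψ.FS) {V : CovRep ψ B} (hV : V.Injective) :
    Function.Injective V.T := by
  refine (injective_iff_map_eq_zero V.T).2 fun q hq => hFS.eq_zero_right fun p => ?_
  refine (injective_iff_map_eq_zero V.σ).1 hV _ ?_
  rw [V.σ_pair, hq, mul_zero]

/-- Multiplying by `T(q)` turns the hypothesis into `T(Θ q) = T(rq)`, and `T` is injective. Thus
`Δ(r)` is the only operator that `π` can send to `σ(r)`. -/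
theorem Injective.eq_lmul (hFS : ψ.FS) {V : CovRep ψ B} (hV : V.Injective) {r : R}
    {Θ : ψ.finiteRank} (h : V.piHom hFS Θ = V.σ r) : Θ.1 = lmul R Q r := by
  refine AddMonoidHom.ext fun q => hV.T_injective hFS ?_
  change V.T (Θ.1 q) = V.T (r • q)
  rw [← V.piHom_mul_T hFS, h, V.T_lsmul]

/-- The elements of `B` fixed from the left by every element that fixes a suitable finite subset
of `T(Q)`. -/
def leftLocal (V : CovRep ψ B) : AddSubgroup B where
  carrier := {x | ∃ s : Finset Q, ∀ b : B, (∀ q ∈ s, b * V.T q = V.T q) → b * x = x}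
  zero_mem' := ⟨∅, fun b _ => mul_zero b⟩
  add_mem' := by
    classical
    rintro x y ⟨s, hs⟩ ⟨t, ht⟩
    refine ⟨s ∪ t, fun b hb => ?_⟩
    rw [mul_add, hs b fun q hq => hb q (by simp [hq]), ht b fun q hq => hb q (by simp [hq])]
  neg_mem' := by
    rintro x ⟨s, hs⟩
    exact ⟨s, fun b hb => by rw [mul_neg, hs b hb]⟩

/-- The elements of `B` fixed from the right by every element that fixes a suitable finite subset
of `S(P)`. -/
def rightLocal (V : CovRep ψ B) : AddSubgroup B where
  carrier := {x | ∃ s : Finset P, ∀ b : B, (∀ p ∈ s, V.S p * b = V.S p) → x * b = x}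
  zero_mem' := ⟨∅, fun b _ => zero_mul b⟩
  add_mem' := by
    classical
    rintro x y ⟨s, hs⟩ ⟨t, ht⟩
    refine ⟨s ∪ t, fun b hb => ?_⟩
    rw [add_mul, hs b fun q hq => hb q (by simp [hq]), ht b fun q hq => hb q (by simp [hq])]
  neg_mem' := by
    rintro x ⟨s, hs⟩
    exact ⟨s, fun b hb => by rw [neg_mul, hs b hb]⟩

/-- As `π(Θ) T(q) = T(Θ q)`, an operator from (FS) fixing a finite subset of `Q` gives a left local
unit. -/
theorem exists_piHom_mul_eq (hFS : ψ.FS) (V : CovRep ψ B) {x : B} (hx : x ∈ V.leftLocal) :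
    ∃ Θ, V.piHom hFS Θ * x = x := by
  obtain ⟨s, hs⟩ := hx
  obtain ⟨Θ, hΘ, -, -, h, -⟩ := hFS s ∅
  exact ⟨⟨Θ, hΘ⟩, hs _ fun q hq => by rw [piHom_mul_T, h q hq]⟩

/-- For `Ω` in `𝓕_Q(P)` there is an element of `π(𝓕_P(Q))` inducing it on `S(P)`. -/
theorem exists_S_mul_piHom (hFS : ψ.FS) (V : CovRep ψ B) {Ω : AddMonoid.End P}
    (hΩ : Ω ∈ ψ.finiteRank') : ∃ Θ, ∀ p, V.S p * V.piHom hFS Θ = V.S (Ω p) := by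
  change Ω ∈ AddSubgroup.closure _ at hΩ
  induction hΩ using AddSubgroup.closure_induction with
  | mem Ω h =>
    obtain ⟨p, q, rfl⟩ := h
    refine ⟨⟨_, ψ.theta_mem q p⟩, fun y => ?_⟩
    rw [piHom_theta, SystemMap.theta'_apply, V.S_lsmul, V.σ_pair, mul_assoc]
  | zero => exact ⟨0, fun p => by rw [map_zero, mul_zero]; exact (map_zero V.S).symm⟩
  | add x y _ _ hx hy =>
    obtain ⟨Θ, h⟩ := hx
    obtain ⟨Θ', h'⟩ := hy
    exact ⟨Θ + Θ', fun p => by rw [map_add, mul_add, h, h', End.add_apply, map_add]⟩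
  | neg x _ hx =>
    obtain ⟨Θ, h⟩ := hx
    exact ⟨-Θ, fun p => by rw [map_neg, mul_neg, h, End.neg_apply, map_neg]⟩

theorem exists_mul_piHom_eq (hFS : ψ.FS) (V : CovRep ψ B) {x : B} (hx : x ∈ V.rightLocal) :
    ∃ Θ, x * V.piHom hFS Θ = x := by
  obtain ⟨s, hs⟩ := hx
  obtain ⟨-, -, Ω, hΩ, -, h⟩ := hFS ∅ s
  obtain ⟨Θ, hΘ⟩ := V.exists_S_mul_piHom hFS hΩ
  exact ⟨Θ, hs _ fun p hp => by rw [hΘ, h p hp]⟩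

theorem T_mem_leftLocal (V : CovRep ψ B) (q : Q) : V.T q ∈ V.leftLocal :=
  ⟨{q}, fun b hb => hb q (by simp)⟩

theorem S_mem_rightLocal (V : CovRep ψ B) (p : P) : V.S p ∈ V.rightLocal :=
  ⟨{p}, fun b hb => hb p (by simp)⟩

theorem leftLocal_mul (V : CovRep ψ B) {x : B} (hx : x ∈ V.leftLocal) (b : B) :
    x * b ∈ V.leftLocal := by
  obtain ⟨s, hs⟩ := hx
  exact ⟨s, fun c hc => by rw [← mul_assoc, hs c hc]⟩

theorem mul_rightLocal (V : CovRep ψ B) (b : B) {x : B} (hx : x ∈ V.rightLocal) :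
    b * x ∈ V.rightLocal := by
  obtain ⟨s, hs⟩ := hx
  exact ⟨s, fun c hc => by rw [mul_assoc, hs c hc]⟩

/-- A local unit writes `x = π(Θ) x` as a sum of terms `T(q) S(p) x`. -/
theorem eq_zero_of_S_mul (hFS : ψ.FS) (V : CovRep ψ B) {x : B} (hx : x ∈ V.leftLocal)
    (h : ∀ p, V.S p * x = 0) : x = 0 := by
  obtain ⟨Θ, hΘ⟩ := V.exists_piHom_mul_eq hFS hx
  rw [← hΘ]
  refine V.piHom_induction hFS (C := fun b => b * x = 0) ?_ (zero_mul x) ?_ ?_ Θ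
  · intro q p; rw [mul_assoc, h, mul_zero]
  · intro a b ha hb; rw [add_mul, ha, hb, add_zero]
  · intro a ha; rw [neg_mul, ha, neg_zero]

theorem eq_zero_of_mul_T (hFS : ψ.FS) (V : CovRep ψ B) {x : B} (hx : x ∈ V.rightLocal)
    (h : ∀ q, x * V.T q = 0) : x = 0 := by
  obtain ⟨Θ, hΘ⟩ := V.exists_mul_piHom_eq hFS hx
  rw [← hΘ]
  refine V.piHom_induction hFS (C := fun b => x * b = 0) ?_ (mul_zero x) ?_ ?_ Θ
  · intro q p; rw [← mul_assoc, h, zero_mul]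
  · intro a b ha hb; rw [mul_add, ha, hb, add_zero]
  · intro a ha; rw [mul_neg, ha, neg_zero]

theorem exists_piHom_mul_σ (hFS : ψ.FS) (V : CovRep ψ B) (Θ : ψ.finiteRank) (r : R) :
    ∃ Θ', V.piHom hFS Θ * V.σ r = V.piHom hFS Θ' := by
  refine V.piHom_induction hFS (C := fun b => ∃ Θ', b * V.σ r = V.piHom hFS Θ') ?_
    ⟨0, by rw [zero_mul, map_zero]⟩ ?_ ?_ Θ
  · intro q p
    exact ⟨⟨_, ψ.theta_mem q (p <• r)⟩, by rw [piHom_theta, V.S_rsmul, mul_assoc]⟩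
  · rintro x y ⟨Θ, h⟩ ⟨Θ', h'⟩
    exact ⟨Θ + Θ', by rw [add_mul, h, h', map_add]⟩
  · rintro x ⟨Θ, h⟩
    exact ⟨-Θ, by rw [neg_mul, h, map_neg]⟩

theorem exists_σ_mul_piHom (hFS : ψ.FS) (V : CovRep ψ B) (r : R) (Θ : ψ.finiteRank) :
    ∃ Θ', V.σ r * V.piHom hFS Θ = V.piHom hFS Θ' := by
  refine V.piHom_induction hFS (C := fun b => ∃ Θ', V.σ r * b = V.piHom hFS Θ') ?_
    ⟨0, by rw [mul_zero, map_zero]⟩ ?_ ?_ Θ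
  · intro q p
    exact ⟨⟨_, ψ.theta_mem (r • q) p⟩, by rw [piHom_theta, V.T_lsmul, mul_assoc]⟩
  · rintro x y ⟨Θ, h⟩ ⟨Θ', h'⟩
    exact ⟨Θ + Θ', by rw [mul_add, h, h', map_add]⟩
  · rintro x ⟨Θ, h⟩
    exact ⟨-Θ, by rw [mul_neg, h, map_neg]⟩

/-- If `σ(r) + y` is annihilated by `S(P) · T(Q)`, where `y` is local on both sides, then it is
of the form `σ(r) - π(Θ)`. -/
theorem exists_eq_sub_piHom (hFS : ψ.FS) (V : CovRep ψ B) {r : R} {y : B} (hl : y ∈ V.leftLocal)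
    (hr : y ∈ V.rightLocal) (h : ∀ p q, V.S p * (V.σ r + y) * V.T q = 0) :
    ∃ Θ, y = -V.piHom hFS Θ := by
  obtain ⟨Θ, hΘ⟩ := V.exists_piHom_mul_eq hFS hl
  obtain ⟨Θ', hΘ'⟩ := V.exists_mul_piHom_eq hFS hr
  -- With local units expanded on both sides, every term contains a factor `S(p) (σ(r) + y) T(q')`.
  have hz : V.piHom hFS Θ * (V.σ r + y) * V.piHom hFS Θ' = 0 := by
    refine V.piHom_induction hFS (C := fun b => b * (V.σ r + y) * V.piHom hFS Θ' = 0) ?_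
      (by rw [zero_mul, zero_mul]) ?_ ?_ Θ
    · intro q p
      refine V.piHom_induction hFS (C := fun b => V.T q * V.S p * (V.σ r + y) * b = 0) ?_
        (mul_zero _) ?_ ?_ Θ'
      · intro q' p'
        rw [mul_assoc (V.T q), ← mul_assoc _ (V.T q'), mul_assoc (V.T q), h, mul_zero, zero_mul]
      · intro a b ha hb; rw [mul_add, ha, hb, add_zero]
      · intro a ha; rw [mul_neg, ha, neg_zero]
    · intro a b ha hb; rw [add_mul, add_mul, ha, hb, add_zero]
    · intro a ha; rw [neg_mul, neg_mul, ha, neg_zero]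
  obtain ⟨Ξ, hΞ⟩ := V.exists_piHom_mul_σ hFS Θ r
  refine ⟨Ξ * Θ', ?_⟩
  -- The local units fix `y`, while `π(Θ) σ(r) π(Θ')` again lies in the image of `π`.
  rw [mul_add, add_mul, hΘ, hΘ', hΞ, ← map_mul] at hz
  exact (neg_eq_of_add_eq_zero_right hz).symm

/-! ### The spanning elements `T(q₁) ⋯ T(qᵢ) σ(r) S(p₁) ⋯ S(pⱼ)` -/

/-- The additive span of the elements `T(q₁) ⋯ T(qᵢ) σ(r) S(p₁) ⋯ S(pⱼ)`. -/
def spans (V : CovRep ψ B) : ℕ → ℕ → AddSubgroup B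
  | 0, 0 => (V.σ : R →+ B).range
  | i + 1, 0 => AddSubgroup.closure {x | ∃ q, ∃ y ∈ V.spans i 0, x = V.T q * y}
  | i, j + 1 => AddSubgroup.closure {x | ∃ y ∈ V.spans i j, ∃ p, x = y * V.S p}

theorem spans_succ_right (V : CovRep ψ B) (i j : ℕ) : V.spans i (j + 1) =
    AddSubgroup.closure {x | ∃ y ∈ V.spans i j, ∃ p, x = y * V.S p} := by
  cases i <;> rw [spans]

theorem mul_S_mem_spans (V : CovRep ψ B) {i j : ℕ} {x : B} (hx : x ∈ V.spans i j) (p : P) :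
    x * V.S p ∈ V.spans i (j + 1) := by
  rw [spans_succ_right]
  exact AddSubgroup.subset_closure ⟨x, hx, p, rfl⟩

theorem spans_succ_left_le (V : CovRep ψ B) {i : ℕ} {A : AddSubgroup B}
    (h : ∀ q, ∀ y ∈ V.spans i 0, V.T q * y ∈ A) : V.spans (i + 1) 0 ≤ A := by
  rw [spans, AddSubgroup.closure_le]
  rintro _ ⟨q, y, hy, rfl⟩
  exact h q y hy

theorem spans_succ_right_le (V : CovRep ψ B) {i j : ℕ} {A : AddSubgroup B}
    (h : ∀ y ∈ V.spans i j, ∀ p, y * V.S p ∈ A) : V.spans i (j + 1) ≤ A := by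
  rw [spans_succ_right, AddSubgroup.closure_le]
  rintro _ ⟨y, hy, p, rfl⟩
  exact h y hy p

theorem σ_mem_spans (V : CovRep ψ B) (r : R) : V.σ r ∈ V.spans 0 0 := by
  rw [spans]
  exact ⟨r, rfl⟩

theorem exists_of_mem_spans_zero (V : CovRep ψ B) {x : B} (hx : x ∈ V.spans 0 0) :
    ∃ r, V.σ r = x := by
  rw [spans] at hx
  exact hx

theorem T_mul_mem_spans (V : CovRep ψ B) (q : Q) {i j : ℕ} {x : B} (hx : x ∈ V.spans i j) :
    V.T q * x ∈ V.spans (i + 1) j := by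
  induction j generalizing x with
  | zero =>
    rw [spans]
    exact AddSubgroup.subset_closure ⟨q, x, hx, rfl⟩
  | succ j ih =>
    refine V.spans_succ_right_le (A := (V.spans (i + 1) (j + 1)).comap
      (AddMonoidHom.mulLeft (V.T q))) (fun y hy p => ?_) hx
    change V.T q * (y * V.S p) ∈ V.spans (i + 1) (j + 1)
    rw [← mul_assoc]
    exact V.mul_S_mem_spans (ih hy) p

theorem σ_mul_mem_spans (V : CovRep ψ B) (r : R) {i j : ℕ} {x : B} (hx : x ∈ V.spans i j) :
    V.σ r * x ∈ V.spans i j := by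
  induction j generalizing x with
  | zero =>
    cases i with
    | zero =>
      obtain ⟨s, rfl⟩ := V.exists_of_mem_spans_zero hx
      rw [← map_mul]
      exact V.σ_mem_spans _
    | succ i =>
      refine V.spans_succ_left_le (A := (V.spans (i + 1) 0).comap
        (AddMonoidHom.mulLeft (V.σ r))) (fun q y hy => ?_) hx
      change V.σ r * (V.T q * y) ∈ V.spans (i + 1) 0
      rw [← mul_assoc, ← V.T_lsmul]
      exact V.T_mul_mem_spans _ hy
  | succ j ih =>
    refine V.spans_succ_right_le (A := (V.spans i (j + 1)).comap
      (AddMonoidHom.mulLeft (V.σ r))) (fun y hy p => ?_) hx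
    change V.σ r * (y * V.S p) ∈ V.spans i (j + 1)
    rw [← mul_assoc]
    exact V.mul_S_mem_spans (ih hy) p

/-- `S(p) T(q) = σ(ψ(p ⊗ q))` cancels the leading letter, and the resulting coefficient is absorbed
by what follows. -/
theorem S_mul_mem_spans (V : CovRep ψ B) (p : P) {i j : ℕ} {x : B} (hx : x ∈ V.spans (i + 1) j) :
    V.S p * x ∈ V.spans i j := by
  induction j generalizing x with
  | zero =>
    refine V.spans_succ_left_le (A := (V.spans i 0).comap
      (AddMonoidHom.mulLeft (V.S p))) (fun q y hy => ?_) hx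
    change V.S p * (V.T q * y) ∈ V.spans i 0
    rw [← mul_assoc, ← V.σ_pair]
    exact V.σ_mul_mem_spans _ hy
  | succ j ih =>
    refine V.spans_succ_right_le (A := (V.spans i (j + 1)).comap
      (AddMonoidHom.mulLeft (V.S p))) (fun y hy p' => ?_) hx
    change V.S p * (y * V.S p') ∈ V.spans i (j + 1)
    rw [← mul_assoc]
    exact V.mul_S_mem_spans (ih hy) p'

theorem mul_σ_mem_spans_zero (V : CovRep ψ B) (r : R) {x : B} (hx : x ∈ V.spans 0 0) :
    x * V.σ r ∈ V.spans 0 0 := by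
  obtain ⟨s, rfl⟩ := V.exists_of_mem_spans_zero hx
  rw [← map_mul]
  exact V.σ_mem_spans _

theorem mul_σ_mem_spans (V : CovRep ψ B) (r : R) {i j : ℕ} {x : B} (hx : x ∈ V.spans i j) :
    x * V.σ r ∈ V.spans i j := by
  cases j with
  | zero =>
    induction i generalizing x with
    | zero => exact V.mul_σ_mem_spans_zero r hx
    | succ i ih =>
      refine V.spans_succ_left_le (A := (V.spans (i + 1) 0).comap
        (AddMonoidHom.mulRight (V.σ r))) (fun q y hy => ?_) hx
      change V.T q * y * V.σ r ∈ V.spans (i + 1) 0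
      rw [mul_assoc]
      exact V.T_mul_mem_spans _ (ih hy)
  | succ j =>
    refine V.spans_succ_right_le (A := (V.spans i (j + 1)).comap
      (AddMonoidHom.mulRight (V.σ r))) (fun y hy p => ?_) hx
    change y * V.S p * V.σ r ∈ V.spans i (j + 1)
    rw [mul_assoc, ← V.S_rsmul]
    exact V.mul_S_mem_spans hy _

theorem mul_T_mem_spans (V : CovRep ψ B) (q : Q) {i j : ℕ} {x : B} (hx : x ∈ V.spans i (j + 1)) :
    x * V.T q ∈ V.spans i j := by
  refine V.spans_succ_right_le (A := (V.spans i j).comap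
    (AddMonoidHom.mulRight (V.T q))) (fun y hy p => ?_) hx
  change y * V.S p * V.T q ∈ V.spans i j
  rw [mul_assoc, ← V.σ_pair]
  exact V.mul_σ_mem_spans _ hy

theorem spans_le_leftLocal (V : CovRep ψ B) (i j : ℕ) : V.spans (i + 1) j ≤ V.leftLocal := by
  induction j with
  | zero => exact V.spans_succ_left_le fun q y _ => V.leftLocal_mul (V.T_mem_leftLocal q) y
  | succ j ih => exact V.spans_succ_right_le fun y hy p => V.leftLocal_mul (ih hy) _

theorem spans_le_rightLocal (V : CovRep ψ B) (i j : ℕ) : V.spans i (j + 1) ≤ V.rightLocal :=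
  V.spans_succ_right_le fun y _ p => V.mul_rightLocal y (V.S_mem_rightLocal p)

/-- Without a unit in `R` the middle factor `σ(r)` is not free of charge; (FS) provides it by
writing `p` as a sum of elements `r p'`. -/
theorem S_mem_spans (hFS : ψ.FS) (V : CovRep ψ B) (p : P) : V.S p ∈ V.spans 0 1 := by
  obtain ⟨-, -, Ω, hΩ, -, h⟩ := hFS ∅ {p}
  rw [← h p (by simp)]
  clear h
  change Ω ∈ AddSubgroup.closure _ at hΩ
  induction hΩ using AddSubgroup.closure_induction with
  | mem Ω h =>
    obtain ⟨p', q, rfl⟩ := h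
    rw [SystemMap.theta'_apply, V.S_lsmul]
    exact V.mul_S_mem_spans (V.σ_mem_spans _) _
  | zero => exact (map_zero V.S) ▸ zero_mem (V.spans 0 1)
  | add x y _ _ hx hy => rw [End.add_apply, map_add]; exact add_mem hx hy
  | neg x _ hx => rw [End.neg_apply, map_neg]; exact neg_mem hx

theorem T_mem_spans (hFS : ψ.FS) (V : CovRep ψ B) (q : Q) : V.T q ∈ V.spans 1 0 := by
  obtain ⟨Θ, hΘ, -, -, h, -⟩ := hFS {q} ∅
  rw [← h q (by simp)]
  clear h
  change Θ ∈ AddSubgroup.closure _ at hΘ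
  induction hΘ using AddSubgroup.closure_induction with
  | mem Θ h =>
    obtain ⟨q', p, rfl⟩ := h
    rw [SystemMap.theta_apply, V.T_rsmul]
    exact V.T_mul_mem_spans _ (V.σ_mem_spans _)
  | zero => exact (map_zero V.T) ▸ zero_mem (V.spans 1 0)
  | add x y _ _ hx hy => rw [End.add_apply, map_add]; exact add_mem hx hy
  | neg x _ hx => rw [End.neg_apply, map_neg]; exact neg_mem hx

theorem S_mul_mem_spans_zero (hFS : ψ.FS) (V : CovRep ψ B) (p : P) {j : ℕ} {x : B}
    (hx : x ∈ V.spans 0 j) : V.S p * x ∈ V.spans 0 (j + 1) := by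
  induction j generalizing x with
  | zero =>
    obtain ⟨r, rfl⟩ := V.exists_of_mem_spans_zero hx
    rw [← V.S_rsmul]
    exact V.S_mem_spans hFS _
  | succ j ih =>
    refine V.spans_succ_right_le (A := (V.spans 0 (j + 2)).comap
      (AddMonoidHom.mulLeft (V.S p))) (fun y hy p' => ?_) hx
    change V.S p * (y * V.S p') ∈ V.spans 0 (j + 2)
    rw [← mul_assoc]
    exact V.mul_S_mem_spans (ih hy) p'

theorem mul_T_mem_spans_zero (hFS : ψ.FS) (V : CovRep ψ B) (q : Q) {i : ℕ} {x : B}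
    (hx : x ∈ V.spans i 0) : x * V.T q ∈ V.spans (i + 1) 0 := by
  induction i generalizing x with
  | zero =>
    obtain ⟨r, rfl⟩ := V.exists_of_mem_spans_zero hx
    rw [← V.T_lsmul]
    exact V.T_mem_spans hFS _
  | succ i ih =>
    refine V.spans_succ_left_le (A := (V.spans (i + 2) 0).comap
      (AddMonoidHom.mulRight (V.T q))) (fun q' y hy => ?_) hx
    change V.T q' * y * V.T q ∈ V.spans (i + 2) 0
    rw [mul_assoc]
    exact V.T_mul_mem_spans q' (ih hy)

/-! ### Homogeneous components -/

/-- The span of the elements `T(q₁) ⋯ T(qᵢ) σ(r) S(p₁) ⋯ S(pⱼ)` with `i - j = n`. -/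
def homogeneous (V : CovRep ψ B) (n : ℤ) : AddSubgroup B :=
  ⨆ k : {k : ℕ × ℕ // (k.1 : ℤ) - k.2 = n}, V.spans k.1.1 k.1.2

theorem spans_le_homogeneous (V : CovRep ψ B) {i j : ℕ} {n : ℤ} (h : (i : ℤ) - j = n) :
    V.spans i j ≤ V.homogeneous n :=
  le_iSup (fun k : {k : ℕ × ℕ // (k.1 : ℤ) - k.2 = n} => V.spans k.1.1 k.1.2) ⟨(i, j), h⟩

theorem homogeneous_le (V : CovRep ψ B) {n : ℤ} {A : AddSubgroup B}
    (h : ∀ i j : ℕ, (i : ℤ) - j = n → V.spans i j ≤ A) : V.homogeneous n ≤ A :=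
  iSup_le fun k => h _ _ k.2

theorem S_mul_mem_homogeneous (hFS : ψ.FS) (V : CovRep ψ B) (p : P) {n : ℤ} {x : B}
    (hx : x ∈ V.homogeneous n) : V.S p * x ∈ V.homogeneous (n - 1) := by
  refine V.homogeneous_le (A := (V.homogeneous (n - 1)).comap
    (AddMonoidHom.mulLeft (V.S p))) (fun i j h x hx => ?_) hx
  cases i with
  | zero =>
    exact V.spans_le_homogeneous (by push_cast at h ⊢; omega)
      (V.S_mul_mem_spans_zero hFS p hx)
  | succ i => exact V.spans_le_homogeneous (by push_cast at h ⊢; omega) (V.S_mul_mem_spans p hx)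

theorem mul_T_mem_homogeneous (hFS : ψ.FS) (V : CovRep ψ B) (q : Q) {n : ℤ} {x : B}
    (hx : x ∈ V.homogeneous n) : x * V.T q ∈ V.homogeneous (n + 1) := by
  refine V.homogeneous_le (A := (V.homogeneous (n + 1)).comap
    (AddMonoidHom.mulRight (V.T q))) (fun i j h x hx => ?_) hx
  cases j with
  | zero =>
    exact V.spans_le_homogeneous (by push_cast at h ⊢; omega)
      (V.mul_T_mem_spans_zero hFS q hx)
  | succ j => exact V.spans_le_homogeneous (by push_cast at h ⊢; omega) (V.mul_T_mem_spans q hx)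

theorem T_mul_mem_homogeneous (V : CovRep ψ B) (q : Q) {n : ℤ} {x : B}
    (hx : x ∈ V.homogeneous n) : V.T q * x ∈ V.homogeneous (n + 1) :=
  V.homogeneous_le (A := (V.homogeneous (n + 1)).comap (AddMonoidHom.mulLeft (V.T q)))
    (fun _ _ h _ hx => V.spans_le_homogeneous (by push_cast at h ⊢; omega)
      (V.T_mul_mem_spans q hx)) hx

theorem σ_mul_mem_homogeneous (V : CovRep ψ B) (r : R) {n : ℤ} {x : B}
    (hx : x ∈ V.homogeneous n) : V.σ r * x ∈ V.homogeneous n :=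
  V.homogeneous_le (A := (V.homogeneous n).comap (AddMonoidHom.mulLeft (V.σ r)))
    (fun _ _ h _ hx => V.spans_le_homogeneous h (V.σ_mul_mem_spans r hx)) hx

theorem mem_leftLocal_of_pos (V : CovRep ψ B) {n : ℤ} (hn : 0 < n) :
    V.homogeneous n ≤ V.leftLocal :=
  V.homogeneous_le fun i j h => by
    obtain _ | i := i
    · omega
    · exact V.spans_le_leftLocal i j

theorem mem_rightLocal_of_neg (V : CovRep ψ B) {n : ℤ} (hn : n < 0) :
    V.homogeneous n ≤ V.rightLocal :=
  V.homogeneous_le fun i j h => by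
    obtain _ | j := j
    · omega
    · exact V.spans_le_rightLocal i j

/-- A surjective representation space is the sum of its homogeneous components. -/
theorem Surjective.iSup_homogeneous (hFS : ψ.FS) {V : CovRep ψ B} (hV : V.Surjective) :
    ⨆ n, V.homogeneous n = ⊤ := by
  set G := ⨆ n, V.homogeneous n
  have hle : ∀ n, V.homogeneous n ≤ G := le_iSup V.homogeneous
  have stable : ∀ (b : B), (∀ n, ∀ x ∈ V.homogeneous n, b * x ∈ G) → ∀ x ∈ G, b * x ∈ G := by
    intro b hb
    have : G ≤ G.comap (AddMonoidHom.mulLeft b) := iSup_le hb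
    exact fun x hx => this hx
  -- Only left multiplication by generators is controlled, so membership in `G` is carried through
  -- the closure together with stability of `G` under left multiplication by `b`.
  have key : ∀ b ∈ NonUnitalSubring.closure (Set.range V.σ ∪ Set.range V.T ∪ Set.range V.S),
      b ∈ G ∧ ∀ x ∈ G, b * x ∈ G := by
    intro b hb
    induction hb using NonUnitalSubring.closure_induction with
    | mem b hb =>
      obtain (⟨r, rfl⟩ | ⟨q, rfl⟩) | ⟨p, rfl⟩ := hb
      · exact ⟨hle 0 (V.spans_le_homogeneous (by norm_num) (V.σ_mem_spans r)),
          stable _ fun n x hx => hle _ (V.σ_mul_mem_homogeneous r hx)⟩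
      · exact ⟨hle 1 (V.spans_le_homogeneous (by norm_num) (V.T_mem_spans hFS q)),
          stable _ fun n x hx => hle _ (V.T_mul_mem_homogeneous q hx)⟩
      · exact ⟨hle (-1) (V.spans_le_homogeneous (by norm_num) (V.S_mem_spans hFS p)),
          stable _ fun n x hx => hle _ (V.S_mul_mem_homogeneous hFS p hx)⟩
    | zero => exact ⟨zero_mem G, fun x _ => by rw [zero_mul]; exact zero_mem G⟩
    | add a b _ _ ha hb =>
      exact ⟨add_mem ha.1 hb.1, fun x hx => by
        rw [add_mul]; exact add_mem (ha.2 x hx) (hb.2 x hx)⟩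
    | neg a _ ha => exact ⟨neg_mem ha.1, fun x hx => by rw [neg_mul]; exact neg_mem (ha.2 x hx)⟩
    | mul a b _ _ ha hb =>
      exact ⟨ha.2 b hb.1, fun x hx => by rw [mul_assoc]; exact ha.2 _ (hb.2 x hx)⟩
  refine eq_top_iff.2 fun b _ => (key b ?_).1
  rw [show NonUnitalSubring.closure _ = ⊤ from hV]
  exact NonUnitalSubring.mem_top b

/-! ### The filtration of the degree zero part -/

/-- The sum of the spans of `T(q₁) ⋯ T(qₖ) σ(r) S(p₁) ⋯ S(pₖ)` with `k ≤ m`. -/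
def core (V : CovRep ψ B) : ℕ → AddSubgroup B
  | 0 => V.spans 0 0
  | m + 1 => V.core m ⊔ V.spans (m + 1) (m + 1)

theorem core_mono (V : CovRep ψ B) : Monotone V.core :=
  monotone_nat_of_le_succ fun m => by rw [core]; exact le_sup_left

theorem spans_le_core (V : CovRep ψ B) (m : ℕ) : V.spans m m ≤ V.core m := by
  cases m with
  | zero => rw [core]
  | succ m => rw [core]; exact le_sup_right

theorem exists_mem_core (V : CovRep ψ B) {x : B} (hx : x ∈ V.homogeneous 0) :
    ∃ m, x ∈ V.core m := by
  rw [← AddSubgroup.mem_iSup_of_directed V.core_mono.directed_le]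
  refine V.homogeneous_le (fun i j h => ?_) hx
  obtain rfl : i = j := by omega
  exact (V.spans_le_core i).trans (le_iSup V.core i)

/-- Compression strips one letter from each side of a word. The bottom layer, having no letters, is
sent to itself by `S(p) σ(r) T(q) = σ(ψ(pr ⊗ q))`. -/
theorem S_mul_mul_T_mem_core (V : CovRep ψ B) (p : P) (q : Q) {m : ℕ} {x : B}
    (hx : x ∈ V.core (m + 1)) : V.S p * x * V.T q ∈ V.core m := by
  let f : B →+ B := (AddMonoidHom.mulRight (V.T q)).comp (AddMonoidHom.mulLeft (V.S p))
  have hspan : ∀ m, V.spans (m + 1) (m + 1) ≤ (V.core m).comap f := fun m x hx =>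
    V.spans_le_core m (V.mul_T_mem_spans q (V.S_mul_mem_spans p hx))
  suffices h : V.core (m + 1) ≤ (V.core m).comap f from h hx
  clear hx
  induction m with
  | zero =>
    rw [core]
    refine sup_le (fun x hx => ?_) (hspan 0)
    rw [core] at hx
    obtain ⟨r, rfl⟩ := V.exists_of_mem_spans_zero hx
    change V.S p * V.σ r * V.T q ∈ V.core 0
    rw [← V.S_rsmul, ← V.σ_pair, core]
    exact V.σ_mem_spans _
  | succ m ih =>
    rw [core]
    exact sup_le (ih.trans (AddSubgroup.comap_mono (V.core_mono m.le_succ))) (hspan _)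

/-- Every layer above the bottom one consists of sums of words beginning with a `T(q)` and ending
with an `S(p)`, hence is local on both sides. -/
theorem exists_sub_mem_local (V : CovRep ψ B) {m : ℕ} {x : B} (hx : x ∈ V.core m) :
    ∃ r, ∃ y ∈ V.leftLocal, y ∈ V.rightLocal ∧ x = V.σ r + y := by
  induction m generalizing x with
  | zero =>
    rw [core] at hx
    obtain ⟨r, rfl⟩ := V.exists_of_mem_spans_zero hx
    exact ⟨r, 0, zero_mem _, zero_mem _, (add_zero _).symm⟩
  | succ m ih =>
    rw [core] at hx
    obtain ⟨a, ha, b, hb, rfl⟩ := AddSubgroup.mem_sup.1 hx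
    obtain ⟨r, y, hy, hy', rfl⟩ := ih ha
    exact ⟨r, y + b, add_mem hy (V.spans_le_leftLocal _ _ hb),
      add_mem hy' (V.spans_le_rightLocal _ _ hb), add_assoc _ _ _⟩

end CovRep

end CuntzPimsner

/-! ### Graded uniqueness -/

namespace CuntzPimsner

variable {R P Q : Type*} [NonUnitalRing R] [AddCommGroup P] [AddCommGroup Q]
  [Bimodule R P] [Bimodule R Q] {ψ : SystemMap R P Q}

namespace CovRep

variable {A B : Type*} [NonUnitalRing A] [NonUnitalRing B] {W : CovRep ψ A} {V : CovRep ψ B}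
  {η : A →ₙ+* B}

theorem Intertwines.map_homogeneous (hη : W.Intertwines V η) {𝒜 : ℤ → AddSubgroup B}
    (hmul : ∀ m n : ℤ, ∀ a ∈ 𝒜 m, ∀ b ∈ 𝒜 n, a * b ∈ 𝒜 (m + n)) (hσ : ∀ r, V.σ r ∈ 𝒜 0)
    (hT : ∀ q, V.T q ∈ 𝒜 1) (hS : ∀ p, V.S p ∈ 𝒜 (-1)) (n : ℤ) :
    W.homogeneous n ≤ (𝒜 n).comap (η : A →+ B) := by
  have h0 : ∀ i : ℕ, W.spans i 0 ≤ (𝒜 i).comap (η : A →+ B) := by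
    intro i
    induction i with
    | zero =>
      intro x hx
      obtain ⟨r, rfl⟩ := W.exists_of_mem_spans_zero hx
      change η (W.σ r) ∈ 𝒜 0
      rw [hη.2.2]
      exact hσ r
    | succ i ih =>
      refine W.spans_succ_left_le fun q y hy => ?_
      change η (W.T q * y) ∈ 𝒜 ((i + 1 : ℕ) : ℤ)
      rw [map_mul, hη.1, Nat.cast_succ, add_comm]
      exact hmul _ _ _ (hT q) _ (ih hy)
  have h1 : ∀ i j : ℕ, W.spans i j ≤ (𝒜 ((i : ℤ) - j)).comap (η : A →+ B) := by
    intro i j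
    induction j with
    | zero => simpa using h0 i
    | succ j ih =>
      refine W.spans_succ_right_le fun y hy p => ?_
      change η (y * W.S p) ∈ 𝒜 ((i : ℤ) - (j + 1 : ℕ))
      rw [map_mul, hη.2.1, show (i : ℤ) - (j + 1 : ℕ) = (i - j) + -1 by push_cast; ring]
      exact hmul _ _ _ (ih hy) _ (hS p)
  exact W.homogeneous_le fun i j h => h ▸ h1 i j

/-- A homomorphism into a graded ring is injective as soon as it is injective on homogeneous
elements. -/
theorem Intertwines.injective_of_homogeneous (hFS : ψ.FS) (hW : W.Surjective)
    (hη : W.Intertwines V η) (hV : V.Graded)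
    (h : ∀ n, ∀ x ∈ W.homogeneous n, η x = 0 → x = 0) : Function.Injective η := by
  obtain ⟨𝒜, hint, hmul, hσ, hT, hS⟩ := hV
  let g : ∀ n : ℤ, W.homogeneous n →+ 𝒜 n := fun n =>
    ((η : A →+ B).comp (W.homogeneous n).subtype).codRestrict (𝒜 n)
      fun x => hη.map_homogeneous hmul hσ hT hS n x.2
  have hcomm : ∀ f, η (DirectSum.coeAddMonoidHom W.homogeneous f) =
      DirectSum.coeAddMonoidHom 𝒜 (DirectSum.map g f) := by
    intro f
    induction f using DirectSum.induction_on with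
    | zero => simp only [map_zero]
    | add f f' hf hf' => simp only [map_add, hf, hf']
    | of n x =>
      rw [DirectSum.map_of, DirectSum.coeAddMonoidHom_of, DirectSum.coeAddMonoidHom_of]
      rfl
  refine (injective_iff_map_eq_zero η).2 fun x hx => ?_
  have hle : ⨆ n, W.homogeneous n ≤ (DirectSum.coeAddMonoidHom W.homogeneous).range :=
    iSup_le fun n x hx => ⟨DirectSum.of (fun n => W.homogeneous n) n ⟨x, hx⟩,
      DirectSum.coeAddMonoidHom_of _ _ _⟩
  rw [hW.iSup_homogeneous hFS] at hle
  obtain ⟨f, rfl⟩ := hle (AddSubgroup.mem_top x)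
  rw [hcomm] at hx
  -- Independence of the graded pieces is used only in the target: it makes each component of `f`
  -- map to zero separately.
  have hz : DirectSum.map g f = 0 :=
    (injective_iff_map_eq_zero (DirectSum.coeAddMonoidHom 𝒜)).1 hint.1 _ hx
  suffices f = 0 by rw [this, map_zero]
  refine DFinsupp.ext fun n => Subtype.ext (h n _ (f n).2 ?_)
  have hn : DirectSum.map g f n = 0 := by rw [hz]; rfl
  rw [DirectSum.map_apply] at hn
  exact congrArg Subtype.val hn

end CovRep

section Relative

variable {B : Type*} [NonUnitalRing B] {V : CovRep ψ B} {hFS : ψ.FS} {J : TwoSidedIdeal R}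
  {hJ : ψ.Compatible J} {η : RelCP hFS J hJ →ₙ+* B}

/-- The compressions of `x` lie in the kernel one layer lower, so they vanish by induction, and this
forces `x = σ(r) - π(Θ)`. Applying `η` gives `σ(r) = π(Θ)` in `B`, whence `r ∈ J` and `Θ = Δ(r)`;
invariance of `𝓞(J)` then gives `x = 0`. -/
theorem eq_zero_of_mem_core (hη : (relCPRep hFS J hJ).Intertwines V η) (hi : V.Injective)
    (hJV : (J : Set R) = V.idealSet hFS) {m : ℕ} {x : RelCP hFS J hJ}
    (hx : x ∈ (relCPRep hFS J hJ).core m) (h0 : η x = 0) : x = 0 := by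
  induction m generalizing x with
  | zero =>
    rw [CovRep.core] at hx
    obtain ⟨r, rfl⟩ := CovRep.exists_of_mem_spans_zero _ hx
    rw [hη.2.2] at h0
    rw [(injective_iff_map_eq_zero V.σ).1 hi r h0, map_zero]
  | succ m ih =>
    obtain ⟨r, y, hl, hr, rfl⟩ := CovRep.exists_sub_mem_local _ hx
    obtain ⟨Θ, rfl⟩ := CovRep.exists_eq_sub_piHom hFS _ hl hr fun p q =>
      ih (CovRep.S_mul_mul_T_mem_core _ p q hx) (by rw [map_mul, map_mul, h0, mul_zero, zero_mul])
    rw [map_add, map_neg, hη.2.2, hη.map_piHom hFS, add_neg_eq_zero] at h0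
    have hrJ : r ∈ J := by
      rw [← SetLike.mem_coe, hJV]
      exact ⟨Θ, h0.symm⟩
    have hΘ : Θ = ⟨lmul R Q r, hJ r hrJ⟩ := Subtype.ext (hi.eq_lmul hFS h0.symm)
    rw [hΘ, relCPRep_CPInvariant hFS J hJ r hrJ, add_neg_cancel]

/-- Positive degrees are lowered by left multiplication by `S(p)`, negative ones raised by right
multiplication by `T(q)`. The products stay in the kernel, and locality on the relevant side lets
them detect `x`. -/
theorem eq_zero_of_mem_homogeneous (hη : (relCPRep hFS J hJ).Intertwines V η) (hi : V.Injective)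
    (hJV : (J : Set R) = V.idealSet hFS) (n : ℤ) {x : RelCP hFS J hJ}
    (hx : x ∈ (relCPRep hFS J hJ).homogeneous n) (h0 : η x = 0) : x = 0 := by
  induction n generalizing x with
  | zero =>
    obtain ⟨m, hm⟩ := CovRep.exists_mem_core _ hx
    exact eq_zero_of_mem_core hη hi hJV hm h0
  | succ n ih =>
    refine CovRep.eq_zero_of_S_mul hFS _ (CovRep.mem_leftLocal_of_pos _ (by omega) hx)
      fun p => ih ?_ (by rw [map_mul, h0, mul_zero])
    simpa using CovRep.S_mul_mem_homogeneous hFS _ p hx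
  | pred n ih =>
    refine CovRep.eq_zero_of_mul_T hFS _ (CovRep.mem_rightLocal_of_neg _ (by omega) hx)
      fun q => ih ?_ (by rw [map_mul, h0, zero_mul])
    simpa using CovRep.mul_T_mem_homogeneous hFS _ q hx

/-- The graded uniqueness theorem. -/
theorem bijective_of_graded (hη : (relCPRep hFS J hJ).Intertwines V η) (hs : V.Surjective)
    (hi : V.Injective) (hg : V.Graded) (hJV : (J : Set R) = V.idealSet hFS) :
    Function.Bijective η :=
  ⟨hη.injective_of_homogeneous hFS (relCPRep_surjective hFS J hJ) hg
    fun n _ => eq_zero_of_mem_homogeneous hη hi hJV n, hs.surjective_of_intertwines hη⟩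

/-! ### The ideal attached to an injective representation -/

theorem CovRep.Intertwines.idealSet_eq {A B : Type*} [NonUnitalRing A] [NonUnitalRing B]
    {W : CovRep ψ A} {V : CovRep ψ B} {η : A →ₙ+* B} (hη : W.Intertwines V η)
    (hi : Function.Injective η) : V.idealSet hFS = W.idealSet hFS := by
  ext r
  refine exists_congr fun Θ => ?_
  rw [← hη.map_piHom hFS, ← hη.2.2, hi.eq_iff]

/-- The ideal `J_{(S,T,σ,B)}`. -/
def CovRep.ideal (hFS : ψ.FS) (V : CovRep ψ B) : TwoSidedIdeal R :=
  TwoSidedIdeal.mk' (V.idealSet hFS) ⟨0, by rw [map_zero, map_zero]⟩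
    (by rintro x y ⟨Θ, h⟩ ⟨Θ', h'⟩; exact ⟨Θ + Θ', by rw [map_add, map_add, h, h']⟩)
    (by rintro x ⟨Θ, h⟩; exact ⟨-Θ, by rw [map_neg, map_neg, h]⟩)
    (by
      rintro x y ⟨Θ, h⟩
      obtain ⟨Θ', h'⟩ := V.exists_σ_mul_piHom hFS x Θ
      exact ⟨Θ', by rw [← h', h, map_mul]⟩)
    (by
      rintro x y ⟨Θ, h⟩
      obtain ⟨Θ', h'⟩ := V.exists_piHom_mul_σ hFS Θ y
      exact ⟨Θ', by rw [← h', h, map_mul]⟩)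

theorem CovRep.mem_ideal {r : R} : r ∈ V.ideal hFS ↔ r ∈ V.idealSet hFS :=
  TwoSidedIdeal.mem_mk' _ _ _ _ _ _ _

/-- Injectivity identifies any `Θ` with `π(Θ) = σ(r)` as `Δ(r)`, which is therefore of finite rank.
-/
theorem CovRep.Injective.compatible_ideal (hi : V.Injective) : ψ.Compatible (V.ideal hFS) := by
  intro r hr
  obtain ⟨Θ, h⟩ := CovRep.mem_ideal.1 hr
  rw [← hi.eq_lmul hFS h]
  exact Θ.2

theorem CovRep.Injective.CPInvariant_ideal (hi : V.Injective) :
    V.CPInvariant hFS (V.ideal hFS) hi.compatible_ideal := by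
  intro r hr
  obtain ⟨Θ, h⟩ := CovRep.mem_ideal.1 hr
  rw [← h]
  exact congrArg _ (Subtype.ext (hi.eq_lmul hFS h).symm)

/-- On an invariant ideal `σ` factors through `Δ`, so an element of `J` killed by `Δ` is killed by
the injective map `σ`. -/
theorem CovRep.CPInvariant.faithful (hV : V.CPInvariant hFS J hJ) (hi : V.Injective) :
    Faithful Q J := by
  intro r hr h
  refine (injective_iff_map_eq_zero V.σ).1 hi r ?_
  rw [← hV r hr, ← map_zero (V.piHom hFS)]
  exact congrArg _ (Subtype.ext h)

end Relative

end CuntzPimsner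

open CuntzPimsner in
theorem theorem3 {R P Q B : Type*} [NonUnitalRing R] [AddCommGroup P] [AddCommGroup Q]
    [Bimodule R P] [Bimodule R Q] (ψ : SystemMap R P Q) (hFS : ψ.FS)
    [NonUnitalRing B] (V : CovRep ψ B) :
    (∀ (J : TwoSidedIdeal R) (hJ : ψ.Compatible J), Faithful Q J →
      ((∃ η : RelCP hFS J hJ →ₙ+* B, (relCPRep hFS J hJ).Intertwines V η) →
        V.CPInvariant hFS J hJ) ∧
      (V.CPInvariant hFS J hJ →
        ∃! η : RelCP hFS J hJ →ₙ+* B, (relCPRep hFS J hJ).Intertwines V η) ∧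
      (V.CPInvariant hFS J hJ →
        ∀ η : RelCP hFS J hJ →ₙ+* B, (relCPRep hFS J hJ).Intertwines V η →
          (Function.Bijective η ↔
            V.Surjective ∧ V.Injective ∧ V.Graded ∧ (J : Set R) = V.idealSet hFS))) ∧
    (V.Surjective → V.Injective → V.Graded →
      ∃ (J : TwoSidedIdeal R) (hJ : ψ.Compatible J), Faithful Q J ∧
        ∃ e : RelCP hFS J hJ ≃+* B,
          (relCPRep hFS J hJ).Intertwines V (e : RelCP hFS J hJ →ₙ+* B)) := by
  refine ⟨fun J hJ hf => ⟨?_, fun hV => ?_, fun hV η hη => ⟨fun hb => ?_, ?_⟩⟩, fun hs hi hg => ?_⟩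
  · rintro ⟨η, hη⟩
    exact (relCPRep_CPInvariant hFS J hJ).of_intertwines hη
  · exact ⟨hV.lift, hV.lift_intertwines,
      fun η hη => hη.unique (relCPRep_surjective hFS J hJ) hV.lift_intertwines⟩
  · refine ⟨(relCPRep_surjective hFS J hJ).of_intertwines hb.2 hη, fun r s h => ?_,
      CovRep.graded_of_bijective hV hη hb, ?_⟩
    · rw [← hη.2.2, ← hη.2.2] at h
      exact relCPRep_injective hFS hJ hf (hb.1 h)
    · rw [hη.idealSet_eq hb.1, relCPRep_idealSet]
  · rintro ⟨hs, hi, hg, hJV⟩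
    exact bijective_of_graded hη hs hi hg hJV
  -- For `J = J_{(S,T,σ,B)}` injectivity yields compatibility, invariance and faithfulness, so
  -- graded uniqueness applies to the induced homomorphism.
  · have hV := hi.CPInvariant_ideal (hFS := hFS)
    refine ⟨V.ideal hFS, hi.compatible_ideal, hV.faithful hi,
      RingEquiv.ofBijective hV.lift (bijective_of_graded hV.lift_intertwines hs hi hg
        (Set.ext fun r => CovRep.mem_ideal)), hV.lift_intertwines⟩
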